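/- **Proposition (formula for $V^{(q)}$, Cramér–Lundberg).** Let $\lambda,\mu,r>0$, $0<\delta<p$ and $q\ge 0$; if $q=0$, assume moreover $\lambda\ne\mu p$ and $\lambda\neq\mu(p-\delta)$. Let $X_t=pt-\sum_{i=1}^{N_t}U_i$, where $N$ is a homogeneous Poisson process with intensity $\lambda$ and the $U_i$ are i.i.d. exponential random variables with parameter $\mu$, independent of $N$, and let $Y_t=X_t-\delta t$. For a spectrally negative Lévy process with Laplace exponent $\psi$ (for $X$: $\psi(\theta)=\log\mathbb E[e^{\theta X_1}]$, $\theta\ge0$) and $\Phi(q)=\sup\{\theta\ge0:\psi(\theta)=q\}$, the $q$-scale function is the function $\mathbb R\to[0,\infty)$ that vanishes on $(-\infty,0)$, is continuous and strictly increasing on $[0,\infty)$, and has Laplace transform $1/(\psi(\theta)-q)$ for $\theta>\Phi(q)$. Let $W^{(q)}$ and $\mathbb W^{(q)}$ be the $q$-scale functions of $X$ and $Y$. Put $$w^{(q)}(x;a)=\begin{cases}W^{(q)}(x-a),&x<0,\\ W^{(q)}(x-a)+\delta\int_0^x\mathbb W^{(q)}(x-y)\,W^{(q)\prime}(y-a)\,dy,&x\ge0,\end{cases}\qquad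 V^{(q)}(x)=\int_0^\infty w^{(q)}(x;-z)\,\frac zr\,\mathbb P(X_r\in dz).$$ Let $$q^{\pm}=\frac{q+\lambda-\mu p\pm\sqrt{(q+\lambda-\mu p)^2+4pq\mu}}{2p},\qquad A^{\pm}=\frac{\mu+q^{\pm}}{q^{+}-q^{-}},$$ let $q_Y^\pm$, $A_Y^\pm$ be the same expressions with $p-\delta$ in place of $p$, let $\gamma(a,x)=\int_0^x e^{-t}t^{a-1}\,dt$ be the lower incomplete gamma function, and for $L\ge0$ let $$S_1(L)=\sum_{m=0}^\infty\frac{(pr(q^-+\mu))^m}{m!(m+1)!}\,\gamma\bigl(m+1,L(q^++\mu)\bigr)\,[pr(q^++\mu)-(m+1)],$$ $$S_2(L)=\sum_{m=0}^\infty\frac{(pr(q^++\mu))^m}{m!(m+1)!}\,\gamma\bigl(m+1,L(q^-+\mu)\bigr)\,[pr(q^-+\mu)-(m+1)].$$ Then the scale functions exist, with $W^{(q)}(x)=\frac1p(A^+e^{q^+x}-A^-e^{q^-x})$ and $\mathbb W^{(q)}(x)=\frac1{p-\delta}(A_Y^+e^{q_Y^+x}-A_Y^-e^{q_Y^-x})$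 for $x\ge0$; the integrals defining $w^{(q)}(x;-z)$ ($x\ge 0$, $z>0$) and $V^{(q)}(x)$ ($x\in\mathbb R$) exist; all the series here and below converge; and: * for $x>0$, $$V^{(q)}(x)=e^{qr}(p-\delta)\mathbb W^{(q)}(x)-\frac1{\mu\lambda}\Bigl[(q+\lambda)\mathbb W^{(q)}(x)-(p-\delta)\mathbb W^{(q)\prime}(x)\Bigr]\Bigl[(q+\lambda)e^{qr}-pC\Bigr],$$ where $$C=e^{-\lambda r}\Bigl[pW^{(q)\prime}(pr)+A^-q^+e^{q^+pr}S_1(pr)-A^+q^-e^{q^-pr}S_2(pr)+\frac{e^{-\mu pr}}{pr}\sum_{m=0}^\infty\frac{(p\lambda\mu r^2)^{m+1}}{m!(m+1)!}\Bigr];$$ * for $-pr\le x\le0$, $$V^{(q)}(x)=e^{-\lambda r}\Bigl[pW^{(q)}(x+pr)+A^-e^{q^+(x+pr)}S_1(x+pr)-A^+e^{q^-(x+pr)}S_2(x+pr)\Bigr];$$ * for $x<-pr$, $V^{(q)}(x)=0$. -/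

import Mathlib

open MeasureTheory ProbabilityTheory Set Filter Topology
open scoped NNReal Nat

noncomputable section

namespace ParisianRefracted

/-- `N` is a homogeneous Poisson process with intensity `lam` under `P`. -/
structure IsPoissonProcess {Ω : Type*} [MeasurableSpace Ω] (P : Measure Ω) (lam : ℝ)
    (N : ℝ≥0 → Ω → ℕ) : Prop where
  measurable : ∀ t, Measurable (N t)
  zero : ∀ᵐ ω ∂P, N 0 ω = 0
  monotone : ∀ᵐ ω ∂P, Monotone (fun t => N t ω)
  rightContinuous : ∀ᵐ ω ∂P, ∀ t, ContinuousWithinAt (fun s => N s ω) (Ici t) t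
  indepIncrements : HasIndepIncrements N P
  increments : ∀ s t : ℝ≥0, s ≤ t →
    HasLaw (fun ω => N t ω - N s ω) (poissonMeasure (lam * ((t : ℝ) - s)).toNNReal) P

/-- The driving data of the Cramér–Lundberg process with exponential claims: a Poisson process `N`
of intensity `lam`, i.i.d. exponential claims `U i` of parameter `mu`, independent of `N`. -/
structure IsClaimModel {Ω : Type*} [MeasurableSpace Ω] (P : Measure Ω) (lam mu : ℝ)
    (N : ℝ≥0 → Ω → ℕ) (U : ℕ → Ω → ℝ) : Prop where
  poisson : IsPoissonProcess P lam N
  measurable : ∀ i, Measurable (U i)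
  law : ∀ i, HasLaw (U i) (expMeasure mu) P
  iIndep : iIndepFun U P
  indep : IndepFun (fun ω t => N t ω) (fun ω i => U i ω) P

/-- The process `X_t = p t - ∑_{i = 1}^{N_t} U_i` (the claims are indexed from `0` here). -/
def cramerLundberg {Ω : Type*} (p : ℝ) (N : ℝ≥0 → Ω → ℕ) (U : ℕ → Ω → ℝ) (t : ℝ≥0) (ω : Ω) : ℝ :=
  p * t - ∑ i ∈ Finset.range (N t ω), U i ω

/-- The process `Y_t = X_t - δ t`. -/
def subtractDrift {Ω : Type*} (X : ℝ≥0 → Ω → ℝ) (delta : ℝ) (t : ℝ≥0) (ω : Ω) : ℝ :=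
  X t ω - delta * t

/-- The Laplace exponent `ψ(θ) = log E[exp (θ X_1)]`. -/
def laplaceExponent {Ω : Type*} [MeasurableSpace Ω] (P : Measure Ω) (X : ℝ≥0 → Ω → ℝ) (θ : ℝ) : ℝ :=
  cgf (X 1) P θ

/-- The right inverse `Φ(q) = sup {θ ≥ 0 : ψ(θ) = q}`. -/
def rightInverse (ψ : ℝ → ℝ) (q : ℝ) : ℝ :=
  sSup {θ : ℝ | 0 ≤ θ ∧ ψ θ = q}

/-- The characterisation of the `q`-scale function of the spectrally negative Lévy process with
Laplace exponent `ψ`. -/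
structure IsScaleFunction (ψ : ℝ → ℝ) (q : ℝ) (W : ℝ → ℝ) : Prop where
  nonneg : ∀ x, 0 ≤ W x
  eq_zero : ∀ x < 0, W x = 0
  strictMonoOn : StrictMonoOn W (Ici 0)
  continuousOn : ContinuousOn W (Ici 0)
  integrableOn : ∀ θ, rightInverse ψ q < θ →
    IntegrableOn (fun x => Real.exp (-θ * x) * W x) (Ioi 0)
  laplace : ∀ θ, rightInverse ψ q < θ →
    ∫ x in Ioi 0, Real.exp (-θ * x) * W x = 1 / (ψ θ - q)

/-- The `q`-scale function (a function with the above properties, if there is one). -/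
def scaleFunction (ψ : ℝ → ℝ) (q : ℝ) : ℝ → ℝ :=
  Classical.epsilon (IsScaleFunction ψ q)

/-- The scale function `w(x; a)` of the process refracted at `0`, built from the scale functions
`W` of `X` and `WY` of `Y`. -/
def refractedScale (W WY : ℝ → ℝ) (delta x a : ℝ) : ℝ :=
  if x < 0 then W (x - a)
  else W (x - a) + delta * ∫ y in (0 : ℝ)..x, WY (x - y) * deriv W (y - a)

/-- The Parisian refracted scale function
`V(x) = ∫_0^∞ w(x; -z) (z / r) P(X_r ∈ dz)`. -/
def parisianScale {Ω : Type*} [MeasurableSpace Ω] (P : Measure Ω) (X : ℝ≥0 → Ω → ℝ)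
    (delta q : ℝ) (r : ℝ≥0) (x : ℝ) : ℝ :=
  ∫ z in Ioi (0 : ℝ),
    refractedScale (scaleFunction (laplaceExponent P X) q)
      (scaleFunction (laplaceExponent P (subtractDrift X delta)) q) delta x (-z) * (z / r)
    ∂(P.map (X r))

/-- The root `q⁺(q)`. -/
def rootPos (p lam mu q : ℝ) : ℝ :=
  (q + lam - mu * p + Real.sqrt ((q + lam - mu * p) ^ 2 + 4 * p * q * mu)) / (2 * p)

/-- The root `q⁻(q)`. -/
def rootNeg (p lam mu q : ℝ) : ℝ :=
  (q + lam - mu * p - Real.sqrt ((q + lam - mu * p) ^ 2 + 4 * p * q * mu)) / (2 * p)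

/-- The coefficient `A⁺`. -/
def coefPos (p lam mu q : ℝ) : ℝ :=
  (mu + rootPos p lam mu q) / (rootPos p lam mu q - rootNeg p lam mu q)

/-- The coefficient `A⁻`. -/
def coefNeg (p lam mu q : ℝ) : ℝ :=
  (mu + rootNeg p lam mu q) / (rootPos p lam mu q - rootNeg p lam mu q)

/-- The lower incomplete gamma function `γ(a, x) = ∫_0^x e^{-t} t^{a-1} dt`. -/
def lowerGamma (a x : ℝ) : ℝ :=
  ∫ t in (0 : ℝ)..x, Real.exp (-t) * t ^ (a - 1)

/-- The `m`-th term `(p r b)^m / (m! (m+1)!) γ(m+1, L a) [p r a - (m+1)]` of the gamma series. -/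
def gammaTerm (p r a b L : ℝ) (m : ℕ) : ℝ :=
  (p * r * b) ^ m / (m ! * (m + 1)! : ℝ) * lowerGamma (m + 1) (L * a) * (p * r * a - (m + 1))

end ParisianRefracted

end

/-! Conditioning on the number of claims before `r` turns an integral against the law of `X_r` into
a series of gamma integrals. For an exponential `g(x) = e^{θ x}` with `θ` one of the two roots of
`ψ(θ) = q`, the series for `∫ g(x + z) (z / r) P(X_r ∈ dz)` splits into the gamma series and a
Bessel-type series, and the latter cancels in the combination of exponentials that is `W`. That
`∫ W(z) (z / r) P(X_r ∈ dz) = e^{q r}` amounts to an identity between the two gamma series, obtained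
by rearranging the double series of `e^a e^b` along its diagonals.

For `x ≥ 0` refraction reproduces, up to a factor depending on `x` only, what it acts on:
integrating the total derivative of `e^{θ y} (p' W_Y(x - y) - D_Y(x - y) / (θ + mu))`, with `p'` the
drift of `Y` and `D_Y` the claim part of `W_Y`, gives `w(x; -z)` as a combination of `W(z)` and
`D(z)`.

The scale functions are identified by injectivity of the Laplace transform: after exponential
tilting it is a moment generating function, finite near `0`. -/

noncomputable section

namespace ParisianRefracted

section IncompleteGamma

theorem ofReal_lowerGamma (a : ℝ) {x : ℝ} (hx : 0 ≤ x) :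
    (lowerGamma a x : ℂ) = Complex.partialGamma a x := by
  rw [lowerGamma, Complex.partialGamma, ← intervalIntegral.integral_ofReal]
  refine intervalIntegral.integral_congr fun t ht => ?_
  rw [uIcc_of_le hx] at ht
  push_cast [Complex.ofReal_cpow ht.1]
  rfl

theorem lowerGamma_add_one {a x : ℝ} (ha : 0 < a) (hx : 0 ≤ x) :
    lowerGamma (a + 1) x = a * lowerGamma a x - Real.exp (-x) * x ^ a := by
  apply Complex.ofReal_injective
  push_cast [ofReal_lowerGamma _ hx, Complex.ofReal_cpow hx]
  exact_mod_cast Complex.partialGamma_add_one (s := a) (by simpa using ha) hx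

theorem lowerGamma_one (x : ℝ) : lowerGamma 1 x = 1 - Real.exp (-x) := by
  simp [lowerGamma]

theorem abs_lowerGamma_le {a x : ℝ} (ha : 1 ≤ a) (hx : 0 ≤ x) : |lowerGamma a x| ≤ x ^ a := by
  have hbound : ∀ t ∈ uIoc 0 x, ‖Real.exp (-t) * t ^ (a - 1)‖ ≤ x ^ (a - 1) := by
    intro t ht
    rw [uIoc_of_le hx] at ht
    rw [Real.norm_of_nonneg (mul_nonneg (Real.exp_pos _).le (Real.rpow_nonneg ht.1.le _))]
    calc Real.exp (-t) * t ^ (a - 1) ≤ 1 * t ^ (a - 1) := by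
          gcongr
          · exact Real.rpow_nonneg ht.1.le _
          · exact Real.exp_le_one_iff.2 (neg_nonpos.2 ht.1.le)
      _ ≤ x ^ (a - 1) := by
          rw [one_mul]
          exact Real.rpow_le_rpow ht.1.le ht.2 (sub_nonneg.2 ha)
  have h := intervalIntegral.norm_integral_le_of_norm_le_const hbound
  rwa [sub_zero, abs_of_nonneg hx, ← Real.rpow_add_one' hx (by linarith), sub_add_cancel] at h

theorem lowerGamma_natCast_add_two (m : ℕ) {x : ℝ} (hx : 0 ≤ x) :
    lowerGamma ((m + 1 : ℕ) + 1) x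
      = (m + 1) * lowerGamma (m + 1) x - Real.exp (-x) * x ^ (m + 1) := by
  rw [lowerGamma_add_one (by positivity) hx, Real.rpow_natCast, Nat.cast_succ]

theorem integral_pow_mul_exp_eq_lowerGamma (m : ℕ) {a : ℝ} (ha : a ≠ 0) (L : ℝ) :
    ∫ y in (0 : ℝ)..L, y ^ m * Real.exp (-(a * y)) = lowerGamma (m + 1) (L * a) / a ^ (m + 1) := by
  have h := intervalIntegral.mul_integral_comp_mul_left
    (f := fun s : ℝ => Real.exp (-s) * s ^ ((m : ℝ) + 1 - 1)) (a := 0) (b := L) (c := a)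
  rw [mul_zero, mul_comm a L] at h
  rw [lowerGamma, ← h, ← intervalIntegral.integral_const_mul, ← intervalIntegral.integral_div]
  refine intervalIntegral.integral_congr fun y _ => ?_
  simp only [add_sub_cancel_right, Real.rpow_natCast, mul_pow, pow_succ]
  field_simp

theorem integral_pow_mul_exp_mul_sub (m : ℕ) {a L : ℝ} (ha : 0 < a) (hL : 0 ≤ L) (t : ℝ) :
    ∫ y in (0 : ℝ)..L, y ^ m * Real.exp (-(a * y)) * (t - y)
      = ((t * a - (m + 1)) * lowerGamma (m + 1) (L * a)
          + (L * a) ^ (m + 1) * Real.exp (-(L * a))) / a ^ (m + 2) := by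
  have hsplit : ∫ y in (0 : ℝ)..L, y ^ m * Real.exp (-(a * y)) * (t - y)
      = t * (∫ y in (0 : ℝ)..L, y ^ m * Real.exp (-(a * y)))
        - ∫ y in (0 : ℝ)..L, y ^ (m + 1) * Real.exp (-(a * y)) := by
    rw [← intervalIntegral.integral_const_mul, ← intervalIntegral.integral_sub
      (Continuous.intervalIntegrable (by fun_prop) _ _)
      (Continuous.intervalIntegrable (by fun_prop) _ _)]
    refine intervalIntegral.integral_congr fun y _ => ?_
    ring
  rw [hsplit, integral_pow_mul_exp_eq_lowerGamma m ha.ne',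
    integral_pow_mul_exp_eq_lowerGamma (m + 1) ha.ne', lowerGamma_natCast_add_two m (by positivity)]
  field_simp
  ring

theorem natCast_add_one_div_factorial_succ (m : ℕ) : ((m : ℝ) + 1) / (m + 1)! = 1 / m ! := by
  rw [Nat.factorial_succ]
  have := Nat.factorial_ne_zero m
  push_cast
  field_simp

theorem abs_sub_natCast_succ_le (t : ℝ) (m : ℕ) : |t - (m + 1)| ≤ (|t| + 1) * (m + 1) := by
  calc |t - (m + 1)| ≤ |t| + |(m : ℝ) + 1| := abs_sub _ _
    _ = |t| + (m + 1) := by rw [abs_of_nonneg (by positivity : (0 : ℝ) ≤ m + 1)]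
    _ ≤ (|t| + 1) * (m + 1) := by nlinarith [abs_nonneg t, Nat.cast_nonneg (α := ℝ) m]

theorem summable_pow_mul_lowerGamma (y t : ℝ) {s : ℝ} (hs : 0 ≤ s) :
    Summable fun m : ℕ => y ^ m / (m ! * (m + 1)! : ℝ) * lowerGamma (m + 1) s * (t - (m + 1)) := by
  have hmajorant := (Real.summable_pow_div_factorial (|y| * s)).mul_left ((|t| + 1) * s)
  refine Summable.of_norm_bounded hmajorant fun m => ?_
  have hgamma : |lowerGamma (m + 1) s| ≤ s ^ (m + 1) := by
    have h := abs_lowerGamma_le (a := m + 1) (by simp) hs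
    rwa [← Nat.cast_succ, Real.rpow_natCast, Nat.cast_succ] at h
  have hfact : (1 : ℝ) ≤ m ! := by exact_mod_cast Nat.factorial_pos m
  rw [Real.norm_eq_abs, abs_mul, abs_mul, abs_div, abs_pow,
    abs_of_pos (show (0 : ℝ) < m ! * (m + 1)! by positivity)]
  calc |y| ^ m / (m ! * (m + 1)! : ℝ) * |lowerGamma (m + 1) s| * |t - (m + 1)|
      ≤ |y| ^ m / (m ! * (m + 1)! : ℝ) * s ^ (m + 1) * ((|t| + 1) * (m + 1)) := by
        gcongr
        exact abs_sub_natCast_succ_le t m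
    _ = |y| ^ m * s ^ (m + 1) * (|t| + 1) / m ! * (((m : ℝ) + 1) / (m + 1)!) := by
        field_simp
    _ ≤ |y| ^ m * s ^ (m + 1) * (|t| + 1) / m ! * 1 := by
        rw [natCast_add_one_div_factorial_succ]
        gcongr
        exact div_le_one_of_le₀ hfact (by positivity)
    _ = (|t| + 1) * s * ((|y| * s) ^ m / m !) := by
        rw [mul_pow]
        ring

theorem summable_gammaTerm (p r b : ℝ) {a L : ℝ} (ha : 0 ≤ a) (hL : 0 ≤ L) :
    Summable (gammaTerm p r a b L) :=
  summable_pow_mul_lowerGamma (p * r * b) (p * r * a) (mul_nonneg hL ha)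

theorem summable_pow_succ_div_factorial_mul_factorial (x : ℝ) :
    Summable fun m : ℕ => x ^ (m + 1) / (m ! * (m + 1)! : ℝ) := by
  refine Summable.of_norm_bounded ((Real.summable_pow_div_factorial |x|).mul_left |x|) fun m => ?_
  have hfact : (1 : ℝ) ≤ (m + 1)! := by exact_mod_cast Nat.factorial_pos (m + 1)
  rw [norm_div, norm_pow, Real.norm_eq_abs,
    Real.norm_of_nonneg (show (0 : ℝ) ≤ m ! * (m + 1)! by positivity), pow_succ', ← mul_div_assoc]
  gcongr
  exact le_mul_of_one_le_right (by positivity) hfact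

end IncompleteGamma

section KendallSeries

theorem hasSum_pow_div_factorial (x : ℝ) : HasSum (fun n : ℕ => x ^ n / n !) (Real.exp x) := by
  rw [Real.exp_eq_exp_ℝ]
  exact NormedSpace.expSeries_div_hasSum_exp x

theorem hasSum_pow_succ_div_factorial (x : ℝ) :
    HasSum (fun n : ℕ => x ^ (n + 1) / (n + 1)!) (Real.exp x - 1) := by
  simpa using (hasSum_nat_add_iff' 1).2 (hasSum_pow_div_factorial x)

theorem hasSum_natCast_mul_pow_div_factorial (x : ℝ) :
    HasSum (fun n : ℕ => n * (x ^ n / n !)) (x * Real.exp x) := by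
  rw [← hasSum_nat_add_iff' 1]
  refine HasSum.congr_fun (by simpa using (hasSum_pow_div_factorial x).mul_left x) fun n => ?_
  rw [Nat.factorial_succ]
  push_cast
  field_simp
  exact pow_succ' x n

theorem hasSum_exp_tail (m : ℕ) {x : ℝ} (hx : 0 ≤ x) :
    HasSum (fun n : ℕ => x ^ (n + m + 1) / (n + m + 1)!)
      (Real.exp x * lowerGamma (m + 1) x / m !) := by
  have hexp : Real.exp x * Real.exp (-x) = 1 := by simp [← Real.exp_add]
  induction m with
  | zero =>
    convert! hasSum_pow_succ_div_factorial x using 1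
    simp [lowerGamma_one, mul_sub, hexp]
  | succ m ih =>
    have h := (hasSum_nat_add_iff' 1).2 ih
    convert! h using 1
    · funext n
      ring_nf
    · rw [lowerGamma_natCast_add_two m hx, Finset.sum_range_one, zero_add, Nat.factorial_succ]
      push_cast
      field_simp
      linear_combination (-x ^ (m + 1)) * hexp

theorem hasSum_sub_mul_pow_div_factorial (x y : ℝ) :
    HasSum (fun z : ℕ × ℕ => ((z.1 : ℝ) - z.2) * (x ^ z.1 / z.1 ! * (y ^ z.2 / z.2 !)))
      ((x - y) * Real.exp (x + y)) := by
  have hmul : ∀ {f g : ℕ → ℝ} {a b : ℝ}, HasSum f a → HasSum g b →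
      HasSum (fun z : ℕ × ℕ => f z.1 * g z.2) (a * b) := fun hf hg =>
    hf.mul hg (summable_mul_of_summable_norm hf.summable.norm hg.summable.norm)
  have h := (hmul (hasSum_natCast_mul_pow_div_factorial x) (hasSum_pow_div_factorial y)).sub
    (hmul (hasSum_pow_div_factorial x) (hasSum_natCast_mul_pow_div_factorial y))
  convert! h using 1
  · funext z
    ring
  · rw [Real.exp_add]
    ring

theorem tsum_prod_eq_tsum_below_add_tsum_above {f : ℕ × ℕ → ℝ} (hf : Summable f)
    (hdiag : ∀ k, f (k, k) = 0) :
    ∑' z, f z = ∑' z : ℕ × ℕ, f (z.2 + z.1 + 1, z.1) + ∑' z : ℕ × ℕ, f (z.1, z.2 + z.1 + 1) := by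
  set e : (ℕ × ℕ) ⊕ (ℕ × ℕ) → ℕ × ℕ :=
    Sum.elim (fun z => (z.2 + z.1 + 1, z.1)) (fun z => (z.1, z.2 + z.1 + 1)) with he
  have hinj : e.Injective := by
    rintro (⟨i, j⟩ | ⟨i, j⟩) (⟨k, l⟩ | ⟨k, l⟩) <;>
      simp only [he, Sum.elim_inl, Sum.elim_inr, Prod.mk.injEq, Sum.inl.injEq, Sum.inr.injEq,
        reduceCtorEq, imp_false] <;> lia
  have hsupport : Function.support f ⊆ range e := by
    rintro ⟨i, j⟩ hij
    rcases lt_trichotomy i j with h | rfl | h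
    · exact ⟨Sum.inr (i, j - i - 1), Prod.ext rfl (by simp only [he, Sum.elim_inr]; lia)⟩
    · exact absurd (hdiag i) hij
    · exact ⟨Sum.inl (j, i - j - 1), Prod.ext (by simp only [he, Sum.elim_inl]; lia) rfl⟩
  have hsum := hf.comp_injective hinj
  rw [← hinj.tsum_eq hsupport]
  exact (hsum.comp_injective Sum.inl_injective).tsum_sum (f := f ∘ e)
    (hsum.comp_injective Sum.inr_injective)

/-- The part `i > j` of the double series of `(i - j) xⁱ / i! · yʲ / j!`, indexed by `j = z.1` and
`i - j - 1 = z.2`. -/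
def belowDiagonalTerm (x y : ℝ) (z : ℕ × ℕ) : ℝ :=
  (z.2 + 1) * (x ^ (z.2 + z.1 + 1) / (z.2 + z.1 + 1)!) * (y ^ z.1 / z.1 !)

theorem summable_belowDiagonalTerm (x y : ℝ) : Summable (belowDiagonalTerm x y) := by
  have hinj : Function.Injective fun z : ℕ × ℕ => (z.2 + z.1 + 1, z.1) := by
    rintro ⟨i, j⟩ ⟨k, l⟩ h
    simp only [Prod.mk.injEq] at h ⊢
    lia
  refine ((hasSum_sub_mul_pow_div_factorial x y).summable.comp_injective hinj).congr fun z => ?_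
  simp only [Function.comp_apply, belowDiagonalTerm]
  push_cast
  ring

theorem tsum_belowDiagonalTerm_sub_swap (x y : ℝ) :
    ∑' z, belowDiagonalTerm x y z - ∑' z, belowDiagonalTerm y x z
      = (x - y) * Real.exp (x + y) := by
  have h := hasSum_sub_mul_pow_div_factorial x y
  rw [← h.tsum_eq, tsum_prod_eq_tsum_below_add_tsum_above h.summable (by simp), sub_eq_add_neg,
    ← tsum_neg]
  congr 1 <;>
  · refine tsum_congr fun z => ?_
    simp only [belowDiagonalTerm]
    push_cast
    ring

theorem hasSum_succ_mul_exp_tail (m : ℕ) {x : ℝ} (hx : 0 ≤ x) :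
    HasSum (fun n : ℕ => (n + 1) * (x ^ (n + (m + 1) + 1) / (n + (m + 1) + 1)!))
      (Real.exp x * lowerGamma (m + 1) x / m ! * (x - (m + 1)) + x ^ (m + 1) / m !) := by
  have htail := hasSum_exp_tail m hx
  have hnext := (hasSum_nat_add_iff' 1).2 htail
  convert! (htail.mul_left x).sub (hnext.mul_left (m + 1 : ℝ)) using 1
  · funext n
    rw [show n + (m + 1) + 1 = n + m + 1 + 1 by ring, show n + 1 + m + 1 = n + m + 1 + 1 by ring,
      Nat.factorial_succ (n + m + 1)]
    push_cast
    field_simp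
    ring
  · rw [Finset.sum_range_one, zero_add, Nat.factorial_succ]
    push_cast
    field_simp
    ring

theorem tsum_belowDiagonalTerm {x : ℝ} (hx : 0 ≤ x) (y : ℝ) :
    ∑' z, belowDiagonalTerm x y z = x * Real.exp x
      + y * Real.exp x *
        ∑' m : ℕ, y ^ m / (m ! * (m + 1)! : ℝ) * lowerGamma (m + 1) x * (x - (m + 1))
      + ∑' m : ℕ, (x * y) ^ (m + 1) / (m ! * (m + 1)! : ℝ) := by
  have hsum := summable_belowDiagonalTerm x y
  rw [hsum.tsum_prod, hsum.prod.tsum_eq_zero_add, add_assoc, ← tsum_mul_left,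
    ← ((summable_pow_mul_lowerGamma y x hx).mul_left _).tsum_add
      (summable_pow_succ_div_factorial_mul_factorial (x * y))]
  congr 1
  · rw [← (hasSum_natCast_mul_pow_div_factorial x).tsum_eq,
      (hasSum_natCast_mul_pow_div_factorial x).summable.tsum_eq_zero_add]
    simp [belowDiagonalTerm]
  · refine tsum_congr fun m => ?_
    simp only [belowDiagonalTerm]
    rw [((hasSum_succ_mul_exp_tail m hx).mul_right _).tsum_eq, mul_pow]
    field_simp
    ring

theorem exp_mul_tsum_lowerGamma_sub_swap {x y : ℝ} (hx : 0 ≤ x) (hy : 0 ≤ y) :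
    x * Real.exp x - y * Real.exp y
      + y * Real.exp x *
        ∑' m : ℕ, y ^ m / (m ! * (m + 1)! : ℝ) * lowerGamma (m + 1) x * (x - (m + 1))
      - x * Real.exp y *
        ∑' m : ℕ, x ^ m / (m ! * (m + 1)! : ℝ) * lowerGamma (m + 1) y * (y - (m + 1))
      = (x - y) * Real.exp (x + y) := by
  rw [← tsum_belowDiagonalTerm_sub_swap, tsum_belowDiagonalTerm hx, tsum_belowDiagonalTerm hy,
    mul_comm y x]
  ring

end KendallSeries

section LaplaceUniqueness

theorem complexMGF_eqOn_of_mgf_eventuallyEq {μ ν : Measure ℝ}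
    (hμ : 0 ∈ interior (integrableExpSet id μ))
    (hν : 0 ∈ interior (integrableExpSet id ν)) (h : mgf id μ =ᶠ[𝓝 0] mgf id ν) :
    EqOn (complexMGF id μ) (complexMGF id ν)
      {z | z.re ∈ interior (integrableExpSet id μ) ∩ interior (integrableExpSet id ν)} := by
  have hconvex := (convex_integrableExpSet (X := id) (μ := μ)).interior.inter
    (convex_integrableExpSet (X := id) (μ := ν)).interior
  have hofReal : Tendsto Complex.ofReal (𝓝[≠] 0) (𝓝[≠] 0) := by
    refine tendsto_nhdsWithin_iff.2
      ⟨?_, eventually_mem_nhdsWithin.mono fun x hx => by simpa using hx⟩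
    simpa using (Complex.continuous_ofReal.tendsto 0).mono_left nhdsWithin_le_nhds
  refine AnalyticOnNhd.eqOn_of_preconnected_of_frequently_eq
    (fun z hz => analyticOnNhd_complexMGF z hz.1) (fun z hz => analyticOnNhd_complexMGF z hz.2)
    (hconvex.linear_preimage Complex.reLm).isPreconnected (z₀ := 0) ⟨hμ, hν⟩
    (hofReal.frequently (Eventually.frequently ?_))
  filter_upwards [h.filter_mono nhdsWithin_le_nhds] with x hx
  rw [complexMGF_ofReal, complexMGF_ofReal, hx]

theorem measure_eq_of_mgf_eventuallyEq {μ ν : Measure ℝ} [IsFiniteMeasure μ] [IsFiniteMeasure ν]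
    (hμ : 0 ∈ interior (integrableExpSet id μ)) (hν : 0 ∈ interior (integrableExpSet id ν))
    (h : mgf id μ =ᶠ[𝓝 0] mgf id ν) : μ = ν := by
  refine Measure.ext_of_charFun (funext fun t => ?_)
  rw [← complexMGF_id_mul_I, ← complexMGF_id_mul_I]
  exact complexMGF_eqOn_of_mgf_eventuallyEq hμ hν h (by simp [hμ, hν])

theorem mem_integrableExpSet_of_mgf_ne_zero {Ω : Type*} [MeasurableSpace Ω] {X : Ω → ℝ}
    {P : Measure Ω} {t : ℝ} (h : mgf X P t ≠ 0) : t ∈ integrableExpSet X P :=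
  not_imp_comm.1 mgf_undef h

end LaplaceUniqueness

section ErlangLaw

theorem gammaPDFReal_natCast_succ (m : ℕ) (mu : ℝ) {y : ℝ} (hy : 0 < y) :
    gammaPDFReal (m + 1) mu y = mu ^ (m + 1) / m ! * y ^ m * Real.exp (-(mu * y)) := by
  rw [gammaPDFReal, if_pos hy.le, Real.Gamma_nat_eq_factorial, add_sub_cancel_right,
    Real.rpow_natCast]
  norm_cast

theorem integral_gammaMeasure_natCast_succ (m : ℕ) {mu : ℝ} (hmu : 0 < mu) (f : ℝ → ℝ) :
    ∫ y, f y ∂gammaMeasure (m + 1) mu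
      = mu ^ (m + 1) / m ! * ∫ y in Ioi 0, y ^ m * Real.exp (-(mu * y)) * f y := by
  have hmeas : Measurable (gammaPDF (m + 1) mu) := (measurable_gammaPDFReal _ _).ennreal_ofReal
  rw [gammaMeasure, integral_withDensity_eq_integral_toReal_smul hmeas
    (ae_of_all _ fun _ => ENNReal.ofReal_lt_top), ← integral_const_mul,
    ← integral_indicator measurableSet_Ioi]
  refine integral_congr_ae ?_
  filter_upwards [compl_mem_ae_iff.2 (measure_singleton (0 : ℝ))] with y hy
  rw [gammaPDF, ENNReal.toReal_ofReal (gammaPDFReal_nonneg (by positivity) hmu y), smul_eq_mul]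
  rcases lt_or_gt_of_ne (show y ≠ 0 from hy) with hneg | hpos
  · rw [indicator_of_notMem (by simpa using hneg.le), gammaPDFReal, if_neg (not_le.2 hneg),
      zero_mul]
  · rw [indicator_of_mem (by simpa using hpos), gammaPDFReal_natCast_succ m mu hpos]
    ring

theorem integral_pow_mul_exp_Ioi (m : ℕ) {c : ℝ} (hc : 0 < c) :
    ∫ y in Ioi 0, y ^ m * Real.exp (-(c * y)) = m ! / c ^ (m + 1) := by
  have h := Real.integral_rpow_mul_exp_neg_mul_Ioi (a := m + 1) (r := c) (by positivity) hc
  simp only [Real.Gamma_nat_eq_factorial, add_sub_cancel_right, Real.rpow_natCast] at h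
  rw [h, ← Nat.cast_add_one, Real.rpow_natCast, one_div_pow]
  ring

theorem integral_pow_mul_exp_mul_exp_sub (m : ℕ) {θ mu : ℝ} (h : 0 < θ + mu) (c : ℝ) :
    ∫ y in Ioi 0, y ^ m * Real.exp (-(mu * y)) * Real.exp (θ * (c - y))
      = Real.exp (θ * c) * (m ! / (θ + mu) ^ (m + 1)) := by
  rw [← integral_pow_mul_exp_Ioi m h, ← integral_const_mul]
  refine setIntegral_congr_fun measurableSet_Ioi fun y _ => ?_
  rw [mul_left_comm, mul_assoc, ← Real.exp_add, ← Real.exp_add]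
  ring_nf

theorem mgf_id_gammaMeasure_natCast_succ (m : ℕ) {mu t : ℝ} (hmu : 0 < mu) (ht : t < mu) :
    mgf id (gammaMeasure (m + 1) mu) t = (mu / (mu - t)) ^ (m + 1) := by
  have h := integral_pow_mul_exp_mul_exp_sub m (θ := -t) (mu := mu) (by linarith) 0
  simp only [zero_sub, mul_zero, Real.exp_zero, one_mul, neg_mul_neg] at h
  simp only [mgf, id, integral_gammaMeasure_natCast_succ m hmu, h, neg_add_eq_sub, div_pow]
  field_simp

variable {Ω : Type*} [MeasurableSpace Ω] {P : Measure Ω} {mu : ℝ}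

theorem mgf_of_hasLaw_expMeasure {V : Ω → ℝ} (hV : HasLaw V (expMeasure mu) P) (hmu : 0 < mu)
    {t : ℝ} (ht : t < mu) : mgf V P t = mu / (mu - t) := by
  have h := mgf_id_gammaMeasure_natCast_succ 0 hmu ht
  simp only [Nat.cast_zero, zero_add, pow_one] at h
  rw [← mgf_id_map hV.aemeasurable, hV.map_eq, expMeasure, h]

theorem ae_nonneg_of_hasLaw_expMeasure {V : Ω → ℝ} (hV : HasLaw V (expMeasure mu) P) :
    ∀ᵐ ω ∂P, 0 ≤ V ω := by
  rw [hV.ae_iff (p := fun x => 0 ≤ x) (measurableSet_setOfPred.1 measurableSet_Ici), ae_iff]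
  simp only [not_le]
  change expMeasure mu (Iio 0) = 0
  rw [expMeasure, gammaMeasure, withDensity_apply _ measurableSet_Iio]
  exact lintegral_gammaPDF_of_nonpos le_rfl

theorem map_sum_range_succ_eq_gammaMeasure {U : ℕ → Ω → ℝ} (hm : ∀ i, Measurable (U i))
    (hU : ∀ i, HasLaw (U i) (expMeasure mu) P) (hind : iIndepFun U P) (hmu : 0 < mu) (m : ℕ) :
    P.map (fun ω => ∑ i ∈ Finset.range (m + 1), U i ω) = gammaMeasure (m + 1) mu := by
  have hmeas : Measurable fun ω => ∑ i ∈ Finset.range (m + 1), U i ω :=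
    Finset.measurable_sum _ fun i _ => hm i
  have := hind.isProbabilityMeasure
  have := isProbabilityMeasure_gammaMeasure (a := m + 1) (by positivity) hmu
  have hsum : ∀ t < mu, mgf id (P.map fun ω => ∑ i ∈ Finset.range (m + 1), U i ω) t
      = (mu / (mu - t)) ^ (m + 1) := by
    intro t ht
    rw [mgf_id_map hmeas.aemeasurable, ← Finset.sum_fn, hind.mgf_sum hm,
      Finset.prod_congr rfl fun i _ => mgf_of_hasLaw_expMeasure (hU i) hmu ht, Finset.prod_const,
      Finset.card_range]
  have hpos : ∀ t < mu, (mu / (mu - t)) ^ (m + 1) ≠ 0 := fun t ht =>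
    pow_ne_zero _ (div_pos hmu (sub_pos.2 ht)).ne'
  have hinterior : ∀ ν : Measure ℝ, (∀ t < mu, mgf id ν t = (mu / (mu - t)) ^ (m + 1)) →
      0 ∈ interior (integrableExpSet id ν) := by
    refine fun ν hν => mem_interior.2 ⟨Iio mu, fun t ht => ?_, isOpen_Iio, hmu⟩
    exact mem_integrableExpSet_of_mgf_ne_zero ((hν t ht).trans_ne (hpos t ht))
  have hgamma := fun t (ht : t < mu) => mgf_id_gammaMeasure_natCast_succ m hmu ht
  refine measure_eq_of_mgf_eventuallyEq (hinterior _ hsum) (hinterior _ hgamma) ?_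
  filter_upwards [Iio_mem_nhds hmu] with t ht
  rw [hsum t ht, hgamma t ht]

end ErlangLaw

section CompoundPoisson

theorem map_eq_sum_of_indepFun {Ω ι β : Type*} [MeasurableSpace Ω] [MeasurableSpace ι]
    [MeasurableSpace β] [Countable ι] [MeasurableSingletonClass ι] {P : Measure Ω} {K : Ω → ι}
    {F : ι → Ω → β} (hK : Measurable K) (hF : ∀ k, Measurable (F k))
    (hind : ∀ k, IndepFun K (F k) P) :
    P.map (fun ω => F (K ω) ω) = Measure.sum fun k => P.map K {k} • P.map (F k) := by
  have hmeas : Measurable fun ω => F (K ω) ω :=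
    (measurable_from_prod_countable_right (f := fun z : ι × Ω => F z.1 z.2) hF).comp
      (hK.prodMk measurable_id)
  ext s hs
  have hunion : (fun ω => F (K ω) ω) ⁻¹' s = ⋃ k, (K ⁻¹' {k} ∩ F k ⁻¹' s) := by
    ext ω
    simp
  have hdisjoint : Pairwise (Function.onFun Disjoint fun k => K ⁻¹' {k} ∩ F k ⁻¹' s) := by
    refine fun i j hij => Disjoint.mono inter_subset_left inter_subset_left ?_
    exact Disjoint.preimage K (disjoint_singleton.2 hij)
  rw [Measure.map_apply hmeas hs, Measure.sum_apply _ hs, hunion, measure_iUnion hdisjoint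
    fun k => (hK (measurableSet_singleton k)).inter (hF k hs)]
  refine tsum_congr fun k => ?_
  rw [Measure.smul_apply, Measure.map_apply (hF k) hs, Measure.map_apply hK
    (measurableSet_singleton k), smul_eq_mul]
  exact (hind k).measure_inter_preimage_eq_mul {k} s (measurableSet_singleton k) hs

variable {Ω : Type*} [MeasurableSpace Ω] {P : Measure Ω} {lam mu : ℝ} {N : ℝ≥0 → Ω → ℕ}
  {U : ℕ → Ω → ℝ}

theorem IsPoissonProcess.hasLaw (hN : IsPoissonProcess P lam N) (t : ℝ≥0) :
    HasLaw (N t) (poissonMeasure (lam * t).toNNReal) P := by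
  have h := (hN.increments 0 t zero_le).congr (Y := N t) (by
    filter_upwards [hN.zero] with ω hω
    simp [hω])
  simpa using h

theorem IsClaimModel.measurable_sum_range (hNU : IsClaimModel P lam mu N U) (k : ℕ) :
    Measurable fun ω => ∑ i ∈ Finset.range k, U i ω :=
  Finset.measurable_sum _ fun i _ => hNU.measurable i

theorem IsClaimModel.measurable_cramerLundberg (hNU : IsClaimModel P lam mu N U) (p : ℝ) (t : ℝ≥0) :
    Measurable (cramerLundberg p N U t) :=
  measurable_const.sub ((measurable_from_prod_countable_right
    (f := fun z : ℕ × Ω => ∑ i ∈ Finset.range z.1, U i z.2) hNU.measurable_sum_range).comp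
      ((hNU.poisson.measurable t).prodMk measurable_id))

theorem IsClaimModel.ae_map_cramerLundberg_le (hNU : IsClaimModel P lam mu N U) (p : ℝ) (t : ℝ≥0) :
    ∀ᵐ z ∂P.map (cramerLundberg p N U t), z ≤ p * t := by
  rw [ae_map_iff (hNU.measurable_cramerLundberg p t).aemeasurable measurableSet_Iic]
  filter_upwards [ae_all_iff.2 fun i => ae_nonneg_of_hasLaw_expMeasure (hNU.law i)] with ω hω
  exact sub_le_self _ (Finset.sum_nonneg fun i _ => hω i)

theorem IsClaimModel.map_cramerLundberg (hNU : IsClaimModel P lam mu N U) (p : ℝ) (t : ℝ≥0) :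
    P.map (cramerLundberg p N U t) = Measure.sum fun k : ℕ =>
      poissonMeasure (lam * t).toNNReal {k} •
        P.map (fun ω => p * t - ∑ i ∈ Finset.range k, U i ω) := by
  rw [← (hNU.poisson.hasLaw t).map_eq]
  refine map_eq_sum_of_indepFun (F := fun k ω => p * t - ∑ i ∈ Finset.range k, U i ω)
    (hNU.poisson.measurable t) (fun k => measurable_const.sub (hNU.measurable_sum_range k))
    fun k => ?_
  exact hNU.indep.comp (measurable_pi_apply t) (show Measurable
    fun u : ℕ → ℝ => p * t - ∑ i ∈ Finset.range k, u i by fun_prop)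

theorem IsClaimModel.integral_map_sub_sum_range_succ (hNU : IsClaimModel P lam mu N U)
    (hmu : 0 < mu) (c : ℝ) (m : ℕ) {f : ℝ → ℝ} (hf : Measurable f) :
    ∫ z, f z ∂P.map (fun ω => c - ∑ i ∈ Finset.range (m + 1), U i ω)
      = mu ^ (m + 1) / m ! * ∫ y in Ioi 0, y ^ m * Real.exp (-(mu * y)) * f (c - y) := by
  have hmap : P.map (fun ω => c - ∑ i ∈ Finset.range (m + 1), U i ω)
      = (gammaMeasure (m + 1) mu).map (fun y => c - y) := by
    rw [← map_sum_range_succ_eq_gammaMeasure hNU.measurable hNU.law hNU.iIndep hmu m,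
      Measure.map_map (by fun_prop) (hNU.measurable_sum_range _)]
    rfl
  rw [hmap, integral_map (by fun_prop) hf.aestronglyMeasurable,
    integral_gammaMeasure_natCast_succ m hmu]

theorem IsClaimModel.hasSum_integral_cramerLundberg (hNU : IsClaimModel P lam mu N U)
    (hlam : 0 ≤ lam) (hmu : 0 < mu) (p : ℝ) (t : ℝ≥0) {f : ℝ → ℝ} (hf : Measurable f)
    (hfi : Integrable f (P.map (cramerLundberg p N U t))) :
    HasSum (fun m : ℕ => Real.exp (-(lam * t)) * ((lam * t * mu) ^ (m + 1) / (m ! * (m + 1)!) *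
        ∫ y in Ioi 0, y ^ m * Real.exp (-(mu * y)) * f (p * t - y)))
      (∫ z, f z ∂(P.map (cramerLundberg p N U t)) - Real.exp (-(lam * t)) * f (p * t)) := by
  have := hNU.iIndep.isProbabilityMeasure
  have hpoisson : ∀ k : ℕ, (poissonMeasure (lam * t).toNNReal {k}).toReal
      = Real.exp (-(lam * t)) * (lam * t) ^ k / k ! := by
    intro k
    rw [← measureReal_def, poissonMeasure_real_singleton, Real.coe_toNNReal _ (by positivity)]
  rw [hNU.map_cramerLundberg] at hfi ⊢
  have h := (hasSum_nat_add_iff' 1).2 (hasSum_integral_measure hfi)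
  convert! h using 1
  · funext m
    rw [integral_smul_measure, hNU.integral_map_sub_sum_range_succ hmu _ m hf, hpoisson,
      smul_eq_mul, mul_pow]
    ring
  · rw [Finset.sum_range_one, integral_smul_measure, hpoisson]
    simp

/-- The Laplace exponent of `X` in closed form; `laplaceExponent_cramerLundberg` identifies the two
on `[0, ∞)`. -/
def cramerLundbergExponent (p lam mu θ : ℝ) : ℝ :=
  p * θ - lam + lam * mu / (θ + mu)

theorem IsClaimModel.mgf_cramerLundberg (hNU : IsClaimModel P lam mu N U) (hlam : 0 ≤ lam)
    (hmu : 0 < mu) (p : ℝ) (t : ℝ≥0) {θ : ℝ} (hθ : 0 ≤ θ) :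
    mgf (cramerLundberg p N U t) P θ = Real.exp (t * cramerLundbergExponent p lam mu θ) := by
  have hmeas := hNU.measurable_cramerLundberg p t
  have := hNU.iIndep.isProbabilityMeasure
  have hint : Integrable (fun z => Real.exp (θ * z)) (P.map (cramerLundberg p N U t)) := by
    refine Integrable.of_bound (by fun_prop) (Real.exp (θ * (p * t))) ?_
    filter_upwards [hNU.ae_map_cramerLundberg_le p t] with z hz
    rw [Real.norm_of_nonneg (Real.exp_pos _).le]
    gcongr
  have hclaims : HasSum
      (fun m : ℕ => Real.exp (-(lam * t)) * ((lam * t * mu) ^ (m + 1) / (m ! * (m + 1)!) *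
        ∫ y in Ioi 0, y ^ m * Real.exp (-(mu * y)) * Real.exp (θ * (p * t - y))))
      (Real.exp (-(lam * t)) * Real.exp (θ * (p * t))
        * (Real.exp (lam * t * mu / (θ + mu)) - 1)) := by
    refine HasSum.congr_fun ((hasSum_pow_succ_div_factorial _).mul_left _) fun m => ?_
    rw [integral_pow_mul_exp_mul_exp_sub m (by positivity), div_pow]
    field_simp
  have h := (hNU.hasSum_integral_cramerLundberg hlam hmu p t (by fun_prop) hint).unique hclaims
  rw [integral_map hmeas.aemeasurable (by fun_prop)] at h
  have hsplit : Real.exp (t * cramerLundbergExponent p lam mu θ) = Real.exp (-(lam * t))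
      * Real.exp (θ * (p * t)) * Real.exp (lam * t * mu / (θ + mu)) := by
    rw [← Real.exp_add, ← Real.exp_add, cramerLundbergExponent]
    ring_nf
  rw [mgf, hsplit]
  linarith

theorem IsClaimModel.laplaceExponent_cramerLundberg (hNU : IsClaimModel P lam mu N U)
    (hlam : 0 ≤ lam) (hmu : 0 < mu) (p : ℝ) {θ : ℝ} (hθ : 0 ≤ θ) :
    laplaceExponent P (cramerLundberg p N U) θ = cramerLundbergExponent p lam mu θ := by
  rw [laplaceExponent, cgf, hNU.mgf_cramerLundberg hlam hmu p 1 hθ, Real.log_exp, NNReal.coe_one,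
    one_mul]

theorem subtractDrift_cramerLundberg {Ω : Type*} (p delta : ℝ) (N : ℝ≥0 → Ω → ℕ)
    (U : ℕ → Ω → ℝ) :
    subtractDrift (cramerLundberg p N U) delta = cramerLundberg (p - delta) N U := by
  funext t ω
  simp only [subtractDrift, cramerLundberg]
  ring

end CompoundPoisson

section RootPair

/-- `u` and `v` are the two roots of `ψ(θ) = q`, the larger one first, where
`ψ(θ) = p θ - lam + lam mu / (θ + mu)`; they are encoded by their sum and product. -/
structure IsRootPair (p lam mu q u v : ℝ) : Prop where
  p_pos : 0 < p
  lam_pos : 0 < lam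
  mu_pos : 0 < mu
  q_nonneg : 0 ≤ q
  lt : v < u
  sum : p * (u + v) = q + lam - mu * p
  prod : p * (u * v) = -(q * mu)

theorem isRootPair_rootPos_rootNeg {p lam mu q : ℝ} (hp : 0 < p) (hlam : 0 < lam) (hmu : 0 < mu)
    (hq : 0 ≤ q) (hq0 : q = 0 → lam ≠ mu * p) :
    IsRootPair p lam mu q (rootPos p lam mu q) (rootNeg p lam mu q) := by
  have hdisc : 0 < (q + lam - mu * p) ^ 2 + 4 * p * q * mu := by
    rcases hq.eq_or_lt with rfl | hqpos
    · have : 0 + lam - mu * p ≠ 0 := by simpa [sub_ne_zero] using hq0 rfl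
      positivity
    · positivity
  have hsqrt := Real.sqrt_pos.2 hdisc
  have hsq := Real.sq_sqrt hdisc.le
  refine ⟨hp, hlam, hmu, hq, ?_, ?_, ?_⟩
  · rw [rootPos, rootNeg]
    gcongr
    linarith
  · rw [rootPos, rootNeg]
    field_simp
    ring
  · rw [rootPos, rootNeg]
    set D := Real.sqrt ((q + lam - mu * p) ^ 2 + 4 * p * q * mu)
    field_simp
    linear_combination -hsq

/-- The scale function of `X` on `[0, ∞)`, in terms of the two roots and continued analytically to
the line. -/
def expScale (p mu u v x : ℝ) : ℝ :=
  1 / p * ((mu + u) / (u - v) * Real.exp (u * x) - (mu + v) / (u - v) * Real.exp (v * x))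

theorem hasDerivAt_exp_const_mul (c x : ℝ) :
    HasDerivAt (fun x => Real.exp (c * x)) (Real.exp (c * x) * c) x := by
  simpa using ((hasDerivAt_id x).const_mul c).exp

theorem hasDerivAt_expScale (p mu u v x : ℝ) : HasDerivAt (expScale p mu u v)
    (1 / p * ((mu + u) / (u - v) * (Real.exp (u * x) * u)
      - (mu + v) / (u - v) * (Real.exp (v * x) * v))) x :=
  (((hasDerivAt_exp_const_mul u x).const_mul _).sub
    ((hasDerivAt_exp_const_mul v x).const_mul _)).const_mul _

theorem continuous_expScale (p mu u v : ℝ) : Continuous (expScale p mu u v) := by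
  unfold expScale
  fun_prop

theorem continuous_deriv_expScale (p mu u v : ℝ) : Continuous (deriv (expScale p mu u v)) := by
  rw [funext fun x => (hasDerivAt_expScale p mu u v x).deriv]
  fun_prop

theorem exp_mul_expScale (p mu u v θ x : ℝ) : Real.exp (-θ * x) * expScale p mu u v x
    = 1 / p * ((mu + u) / (u - v) * Real.exp ((u - θ) * x)
        - (mu + v) / (u - v) * Real.exp ((v - θ) * x)) := by
  rw [show (u - θ) * x = -θ * x + u * x by ring, show (v - θ) * x = -θ * x + v * x by ring,
    Real.exp_add, Real.exp_add, expScale]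
  ring

theorem integrableOn_exp_mul_expScale {u v θ : ℝ} (hu : u < θ) (hv : v < θ) (p mu : ℝ) :
    IntegrableOn (fun x => Real.exp (-θ * x) * expScale p mu u v x) (Ioi 0) := by
  simp only [exp_mul_expScale]
  exact (((integrableOn_exp_mul_Ioi (sub_neg.2 hu) 0).const_mul _).sub
    ((integrableOn_exp_mul_Ioi (sub_neg.2 hv) 0).const_mul _)).const_mul _

theorem integral_exp_mul_expScale {u v θ : ℝ} (hu : u < θ) (hv : v < θ) (p mu : ℝ) :
    ∫ x in Ioi 0, Real.exp (-θ * x) * expScale p mu u v x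
      = 1 / p * ((mu + u) / (u - v) * (1 / (θ - u)) - (mu + v) / (u - v) * (1 / (θ - v))) := by
  have hexp : ∀ c < θ, ∫ x in Ioi 0, Real.exp ((c - θ) * x) = 1 / (θ - c) := fun c hc => by
    rw [integral_exp_mul_Ioi (sub_neg.2 hc), mul_zero, Real.exp_zero, neg_div, ← div_neg, neg_sub]
  simp only [exp_mul_expScale]
  rw [integral_const_mul, integral_sub ((integrableOn_exp_mul_Ioi (sub_neg.2 hu) 0).const_mul _)
    ((integrableOn_exp_mul_Ioi (sub_neg.2 hv) 0).const_mul _), integral_const_mul,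
    integral_const_mul, hexp u hu, hexp v hv]

namespace IsRootPair

variable {p lam mu q u v : ℝ} (h : IsRootPair p lam mu q u v)
include h

theorem sub_pos : 0 < u - v := _root_.sub_pos.2 h.lt

theorem mul_nonpos : u * v ≤ 0 := by
  nlinarith [h.prod, mul_nonneg h.q_nonneg h.mu_pos.le, h.p_pos]

theorem left_nonneg : 0 ≤ u := by
  nlinarith [h.mul_nonpos, h.lt]

theorem right_nonpos : v ≤ 0 := by
  nlinarith [h.mul_nonpos, h.lt]

theorem left_add_mu_pos : 0 < u + mu := add_pos_of_nonneg_of_pos h.left_nonneg h.mu_pos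

theorem mul_add_mu : p * ((u + mu) * (v + mu)) = lam * mu := by
  linear_combination h.prod + mu * h.sum

theorem right_add_mu_pos : 0 < v + mu := by
  have hpos := mul_pos h.lam_pos h.mu_pos
  rw [← h.mul_add_mu] at hpos
  exact pos_of_mul_pos_right (pos_of_mul_pos_right hpos h.p_pos.le) h.left_add_mu_pos.le

theorem exponent_sub {θ : ℝ} (hθ : θ + mu ≠ 0) :
    cramerLundbergExponent p lam mu θ - q = p * ((θ - u) * (θ - v)) / (θ + mu) := by
  rw [cramerLundbergExponent]
  field_simp
  linear_combination θ * h.sum - h.prod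

theorem exponent_left : cramerLundbergExponent p lam mu u = q := by
  simpa [sub_eq_zero] using h.exponent_sub h.left_add_mu_pos.ne'

theorem exponent_right : cramerLundbergExponent p lam mu v = q := by
  simpa [sub_eq_zero] using h.exponent_sub h.right_add_mu_pos.ne'

theorem lt_exponent {θ : ℝ} (hθ : u < θ) : q < cramerLundbergExponent p lam mu θ := by
  have hmu : 0 < θ + mu := by linarith [h.left_add_mu_pos]
  rw [← _root_.sub_pos, h.exponent_sub hmu.ne']
  exact div_pos (mul_pos h.p_pos (mul_pos (_root_.sub_pos.2 hθ)
    (_root_.sub_pos.2 (h.lt.trans hθ)))) hmu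

theorem rightInverse_eq {ψ : ℝ → ℝ} (hψ : EqOn ψ (cramerLundbergExponent p lam mu) (Ici 0)) :
    rightInverse ψ q = u := by
  refine IsGreatest.csSup_eq
    ⟨⟨h.left_nonneg, (hψ h.left_nonneg).trans h.exponent_left⟩, fun θ hθ => ?_⟩
  by_contra! hlt
  exact (h.lt_exponent hlt).ne' ((hψ hθ.1).symm.trans hθ.2)

theorem expScale_zero : expScale p mu u v 0 = 1 / p := by
  have := h.sub_pos
  simp only [expScale, mul_zero, Real.exp_zero]
  field_simp
  ring

theorem deriv_expScale_pos (x : ℝ) : 0 < deriv (expScale p mu u v) x := by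
  rw [(hasDerivAt_expScale p mu u v x).deriv]
  refine mul_pos (one_div_pos.2 h.p_pos) ?_
  have hu : 0 < (mu + u) / (u - v) * Real.exp (u * x) :=
    mul_pos (div_pos (by linarith [h.left_add_mu_pos]) h.sub_pos) (Real.exp_pos _)
  have hv : 0 < (mu + v) / (u - v) * Real.exp (v * x) :=
    mul_pos (div_pos (by linarith [h.right_add_mu_pos]) h.sub_pos) (Real.exp_pos _)
  nlinarith [mul_nonneg hu.le h.left_nonneg, mul_nonneg hv.le (neg_nonneg.2 h.right_nonpos),
    mul_pos hv h.sub_pos, mul_pos hu h.sub_pos]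

theorem strictMono_expScale : StrictMono (expScale p mu u v) :=
  strictMono_of_deriv_pos h.deriv_expScale_pos

theorem integral_exp_mul_expScale {θ : ℝ} (hθ : u < θ) :
    ∫ x in Ioi 0, Real.exp (-θ * x) * expScale p mu u v x
      = 1 / (cramerLundbergExponent p lam mu θ - q) := by
  have hθmu : 0 < θ + mu := by linarith [h.left_add_mu_pos]
  have hθu : 0 < θ - u := _root_.sub_pos.2 hθ
  have hθv : 0 < θ - v := _root_.sub_pos.2 (h.lt.trans hθ)
  have := h.sub_pos
  have := h.p_pos
  rw [ParisianRefracted.integral_exp_mul_expScale hθ (h.lt.trans hθ), h.exponent_sub hθmu.ne']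
  field_simp
  ring

theorem isScaleFunction {ψ : ℝ → ℝ} (hψ : EqOn ψ (cramerLundbergExponent p lam mu) (Ici 0)) :
    IsScaleFunction ψ q ((Ici 0).indicator (expScale p mu u v)) := by
  have hIci : EqOn ((Ici 0).indicator (expScale p mu u v)) (expScale p mu u v) (Ici 0) :=
    eqOn_indicator
  have hIoi : ∀ θ : ℝ, EqOn (fun x => Real.exp (-θ * x) * (Ici 0).indicator (expScale p mu u v) x)
      (fun x => Real.exp (-θ * x) * expScale p mu u v x) (Ioi 0) := fun θ x hx => by
    simp only [hIci (Ioi_subset_Ici_self hx)]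
  refine ⟨fun x => indicator_nonneg (fun y hy => ?_) x, fun x hx => ?_, ?_, ?_, ?_, ?_⟩
  · have hmono := h.strictMono_expScale.monotone hy
    rw [h.expScale_zero] at hmono
    exact (one_div_pos.2 h.p_pos).le.trans hmono
  · exact indicator_of_notMem (by simpa using hx) _
  · exact (h.strictMono_expScale.strictMonoOn _).congr hIci.symm
  · exact (continuous_expScale p mu u v).continuousOn.congr hIci
  · intro θ hθ
    rw [h.rightInverse_eq hψ] at hθ
    rw [integrableOn_congr_fun (hIoi θ) measurableSet_Ioi]
    exact integrableOn_exp_mul_expScale hθ (h.lt.trans hθ) p mu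
  · intro θ hθ
    rw [h.rightInverse_eq hψ] at hθ
    rw [setIntegral_congr_fun measurableSet_Ioi (hIoi θ), h.integral_exp_mul_expScale hθ,
      hψ (h.left_nonneg.trans hθ.le)]

end IsRootPair

end RootPair

section ScaleFunctionUniqueness

/-- The measure `exp (-c x) f(x) dx` on `(0, ∞)`, whose moment generating function at `t` is the
Laplace transform of `f` at `c - t`. -/
def expTilt (f : ℝ → ℝ) (c : ℝ) : Measure ℝ :=
  (volume.restrict (Ioi 0)).withDensity fun x => ENNReal.ofReal (Real.exp (-c * x) * f x)

variable {f : ℝ → ℝ} {c : ℝ}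

theorem toReal_expTilt_density_smul (hf : ∀ x, 0 ≤ f x) (c t x : ℝ) :
    (ENNReal.ofReal (Real.exp (-c * x) * f x)).toReal • Real.exp (t * x)
      = Real.exp (-(c - t) * x) * f x := by
  rw [ENNReal.toReal_ofReal (mul_nonneg (Real.exp_pos _).le (hf x)), smul_eq_mul, mul_right_comm,
    ← Real.exp_add]
  ring_nf

theorem mem_integrableExpSet_expTilt (hf : ∀ x, 0 ≤ f x)
    (hc : IntegrableOn (fun x => Real.exp (-c * x) * f x) (Ioi 0)) {t : ℝ}
    (ht : IntegrableOn (fun x => Real.exp (-(c - t) * x) * f x) (Ioi 0)) :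
    t ∈ integrableExpSet id (expTilt f c) := by
  refine (integrable_withDensity_iff_integrable_smul₀'
    hc.aestronglyMeasurable.aemeasurable.ennreal_ofReal
    (ae_of_all _ fun _ => ENNReal.ofReal_lt_top)).2 ?_
  simpa only [id, toReal_expTilt_density_smul hf, IntegrableOn] using ht

theorem mgf_expTilt (hf : ∀ x, 0 ≤ f x)
    (hc : IntegrableOn (fun x => Real.exp (-c * x) * f x) (Ioi 0)) (t : ℝ) :
    mgf id (expTilt f c) t = ∫ x in Ioi 0, Real.exp (-(c - t) * x) * f x := by
  rw [mgf, expTilt, integral_withDensity_eq_integral_toReal_smul₀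
    hc.aestronglyMeasurable.aemeasurable.ennreal_ofReal
    (ae_of_all _ fun _ => ENNReal.ofReal_lt_top)]
  simp only [id, toReal_expTilt_density_smul hf]

theorem ae_eq_of_integral_exp_mul_eq {f g : ℝ → ℝ} {c : ℝ} (hf : ∀ x, 0 ≤ f x) (hg : ∀ x, 0 ≤ g x)
    (hfi : ∀ θ > c, IntegrableOn (fun x => Real.exp (-θ * x) * f x) (Ioi 0))
    (hgi : ∀ θ > c, IntegrableOn (fun x => Real.exp (-θ * x) * g x) (Ioi 0))
    (h : ∀ θ > c, ∫ x in Ioi 0, Real.exp (-θ * x) * f x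
      = ∫ x in Ioi 0, Real.exp (-θ * x) * g x) :
    f =ᵐ[volume.restrict (Ioi 0)] g := by
  have hf₁ := hfi (c + 1) (by linarith)
  have hg₁ := hgi (c + 1) (by linarith)
  have : IsFiniteMeasure (expTilt f (c + 1)) :=
    isFiniteMeasure_withDensity hf₁.lintegral_lt_top.ne
  have : IsFiniteMeasure (expTilt g (c + 1)) :=
    isFiniteMeasure_withDensity hg₁.lintegral_lt_top.ne
  have hinterior : ∀ k : ℝ → ℝ, (∀ x, 0 ≤ k x) →
      (∀ θ > c, IntegrableOn (fun x => Real.exp (-θ * x) * k x) (Ioi 0)) →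
      0 ∈ interior (integrableExpSet id (expTilt k (c + 1))) := fun k hk hki =>
    mem_interior.2 ⟨Iio 1, fun t ht => mem_integrableExpSet_expTilt hk (hki _ (by linarith))
      (hki _ (by linarith [mem_Iio.1 ht])), isOpen_Iio, by simp⟩
  have hmgf : mgf id (expTilt f (c + 1)) =ᶠ[𝓝 0] mgf id (expTilt g (c + 1)) := by
    filter_upwards [Iio_mem_nhds one_pos] with t ht
    rw [mgf_expTilt hf hf₁, mgf_expTilt hg hg₁]
    exact h _ (by linarith [mem_Iio.1 ht])
  have heq : expTilt f (c + 1) = expTilt g (c + 1) :=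
    measure_eq_of_mgf_eventuallyEq (hinterior f hf hfi) (hinterior g hg hgi) hmgf
  rw [expTilt, expTilt, withDensity_eq_iff hf₁.aestronglyMeasurable.aemeasurable.ennreal_ofReal
    hg₁.aestronglyMeasurable.aemeasurable.ennreal_ofReal hf₁.lintegral_lt_top.ne] at heq
  filter_upwards [heq] with x hx
  have hexp := Real.exp_pos (-(c + 1) * x)
  exact mul_left_cancel₀ hexp.ne' ((ENNReal.ofReal_eq_ofReal_iff (mul_nonneg hexp.le (hf x))
    (mul_nonneg hexp.le (hg x))).1 hx)

theorem IsScaleFunction.eq {ψ : ℝ → ℝ} {q : ℝ} {W₁ W₂ : ℝ → ℝ} (h₁ : IsScaleFunction ψ q W₁)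
    (h₂ : IsScaleFunction ψ q W₂) : W₁ = W₂ := by
  have hae := ae_eq_of_integral_exp_mul_eq h₁.nonneg h₂.nonneg h₁.integrableOn h₂.integrableOn
    fun θ hθ => (h₁.laplace θ hθ).trans (h₂.laplace θ hθ).symm
  have hIoi : EqOn W₁ W₂ (Ioi 0) := Measure.eqOn_open_of_ae_eq hae isOpen_Ioi
    (h₁.continuousOn.mono Ioi_subset_Ici_self) (h₂.continuousOn.mono Ioi_subset_Ici_self)
  have hIci : EqOn W₁ W₂ (Ici 0) := hIoi.of_subset_closure h₁.continuousOn h₂.continuousOn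
    Ioi_subset_Ici_self (closure_Ioi (0 : ℝ)).ge
  funext x
  rcases lt_or_ge x 0 with hneg | hnonneg
  · rw [h₁.eq_zero x hneg, h₂.eq_zero x hneg]
  · exact hIci hnonneg

theorem IsRootPair.scaleFunction_eq {p lam mu q u v : ℝ} (h : IsRootPair p lam mu q u v)
    {ψ : ℝ → ℝ} (hψ : EqOn ψ (cramerLundbergExponent p lam mu) (Ici 0)) :
    scaleFunction ψ q = (Ici 0).indicator (expScale p mu u v) :=
  (Classical.epsilon_spec ⟨_, h.isScaleFunction hψ⟩ :
    IsScaleFunction ψ q (scaleFunction ψ q)).eq (h.isScaleFunction hψ)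

end ScaleFunctionUniqueness

section KendallIntegral

/-- The integral `∫_0^∞ g(x + z) 1_{x + z ≥ 0} (z / r) ν(dz)`. For `ν` the law of `X_r`, Kendall's
identity relates the weight `z / r` to the first passage times of `X`. -/
def kendallIntegral (ν : Measure ℝ) (r x : ℝ) (g : ℝ → ℝ) : ℝ :=
  ∫ z in Ioi 0, (Ici 0).indicator g (x + z) * (z / r) ∂ν

variable {ν : Measure ℝ} {f g : ℝ → ℝ} {b : ℝ}

theorem integrableOn_indicator_comp_add_mul [IsFiniteMeasure ν] (hν : ∀ᵐ z ∂ν, z ≤ b)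
    (hg : Continuous g) (r x : ℝ) :
    IntegrableOn (fun z => (Ici 0).indicator g (x + z) * (z / r)) (Ioi 0) ν := by
  have hcompact : IntegrableOn (fun z => g (x + z) * (z / r)) (Icc 0 b) ν :=
    Continuous.integrableOn_Icc (by fun_prop)
  have hsubset : Ioi 0 ≤ᵐ[ν] Icc 0 b := by
    filter_upwards [hν] with z hz hz0
    exact ⟨le_of_lt hz0, hz⟩
  have hcut := (hcompact.mono_set_ae hsubset).indicator
    (measurableSet_le measurable_const (measurable_const_add x) : MeasurableSet {z | 0 ≤ x + z})
  refine hcut.congr (ae_of_all _ fun z => ?_)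
  by_cases hz : 0 ≤ x + z <;> simp [hz]

theorem kendallIntegral_mul_sub_mul [IsFiniteMeasure ν] (hν : ∀ᵐ z ∂ν, z ≤ b)
    (hf : Continuous f) (hg : Continuous g) (r x α β : ℝ) :
    kendallIntegral ν r x (fun y => α * f y - β * g y)
      = α * kendallIntegral ν r x f - β * kendallIntegral ν r x g := by
  simp only [kendallIntegral]
  rw [← integral_const_mul, ← integral_const_mul,
    ← integral_sub ((integrableOn_indicator_comp_add_mul hν hf r x).const_mul α)
      ((integrableOn_indicator_comp_add_mul hν hg r x).const_mul β)]
  refine integral_congr_ae (ae_of_all _ fun z => ?_)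
  by_cases hz : 0 ≤ x + z <;> simp [hz]
  ring

theorem kendallIntegral_eq_zero (hν : ∀ᵐ z ∂ν, z ≤ b) {x : ℝ} (hx : x < -b) (r : ℝ) (g : ℝ → ℝ) :
    kendallIntegral ν r x g = 0 := by
  refine integral_eq_zero_of_ae (ae_restrict_of_ae ?_)
  filter_upwards [hν] with z hz
  have hneg : ¬ 0 ≤ x + z := by linarith
  simp [hneg]

section Model

variable {Ω : Type*} [MeasurableSpace Ω] {P : Measure Ω} {lam mu : ℝ} {N : ℝ≥0 → Ω → ℕ}
  {U : ℕ → Ω → ℝ} {p x : ℝ} {r : ℝ≥0} (hNU : IsClaimModel P lam mu N U)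
include hNU

theorem IsClaimModel.isProbabilityMeasure_map_cramerLundberg (p : ℝ) (t : ℝ≥0) :
    IsProbabilityMeasure (P.map (cramerLundberg p N U t)) :=
  have := hNU.iIndep.isProbabilityMeasure
  Measure.isProbabilityMeasure_map (hNU.measurable_cramerLundberg p t).aemeasurable

theorem IsClaimModel.hasSum_kendallIntegral_cramerLundberg (hlam : 0 ≤ lam) (hmu : 0 < mu)
    (hr : 0 < r) (hxp : -(p * r) ≤ x) (hx : x ≤ 0) (hg : Continuous g) :
    HasSum (fun m : ℕ => Real.exp (-(lam * r)) * ((lam * r * mu) ^ (m + 1) / (m ! * (m + 1)!) *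
        ∫ y in (0 : ℝ)..(p * r + x), y ^ m * Real.exp (-(mu * y)) *
          (g (p * r + x - y) * ((p * r - y) / r))))
      (kendallIntegral (P.map (cramerLundberg p N U r)) r x g
        - Real.exp (-(lam * r)) * (p * g (p * r + x))) := by
  have := hNU.isProbabilityMeasure_map_cramerLundberg p r
  have hr₀ : (r : ℝ) ≠ 0 := by exact_mod_cast hr.ne'
  set f : ℝ → ℝ := fun z => (Ici 0).indicator g (x + z) * (z / r) with hf
  have hf_meas : Measurable f :=
    ((hg.measurable.indicator measurableSet_Ici).comp (measurable_const_add x)).mul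
      (measurable_id.div_const _)
  have hf_zero : ∀ z ∉ Ioi (0 : ℝ), f z = 0 := fun z (hz : ¬ 0 < z) => by
    rcases (not_lt.1 hz).eq_or_lt with rfl | hneg
    · simp [hf]
    · have : ¬ 0 ≤ x + z := by linarith
      simp [hf, this]
  have hf_int : Integrable f (P.map (cramerLundberg p N U r)) :=
    (integrableOn_iff_integrable_of_support_subset fun z hz =>
      not_not.1 fun hz' => hz (hf_zero z hz')).1
      (integrableOn_indicator_comp_add_mul (hNU.ae_map_cramerLundberg_le p r) hg r x)
  have hsum := hNU.hasSum_integral_cramerLundberg hlam hmu p r hf_meas hf_int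
  rw [← setIntegral_eq_integral_of_forall_compl_eq_zero hf_zero] at hsum
  have hf_pr : f (p * r) = p * g (p * r + x) := by
    have : 0 ≤ p * r + x := by linarith
    simp only [hf, add_comm x, indicator_of_mem (mem_Ici.2 this)]
    field_simp
  have hf_term : ∀ m : ℕ, ∫ y in Ioi 0, y ^ m * Real.exp (-(mu * y)) * f (p * r - y)
      = ∫ y in (0 : ℝ)..(p * r + x), y ^ m * Real.exp (-(mu * y)) *
          (g (p * r + x - y) * ((p * r - y) / r)) := fun m => by
    rw [intervalIntegral.integral_of_le (by linarith), ← Ioi_inter_Iic,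
      ← setIntegral_indicator measurableSet_Iic]
    congr with y
    by_cases hy : y ≤ p * r + x
    · have : 0 ≤ x + (p * r - y) := by linarith
      simp only [hf, indicator_of_mem (mem_Ici.2 this), indicator_of_mem (mem_Iic.2 hy)]
      ring_nf
    · have : ¬ 0 ≤ x + (p * r - y) := by linarith
      simp [hf, this, hy]
  simp only [hf_term] at hsum
  rwa [hf_pr] at hsum

theorem IsClaimModel.kendallIntegral_exp_cramerLundberg (hlam : 0 ≤ lam) (hmu : 0 < mu) (hr : 0 < r)
    (hxp : -(p * r) ≤ x) (hx : x ≤ 0) {θ b : ℝ} (ha : 0 < θ + mu)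
    (hab : p * ((θ + mu) * b) = lam * mu) :
    kendallIntegral (P.map (cramerLundberg p N U r)) r x (fun y => Real.exp (θ * y))
      = Real.exp (-(lam * r)) * (p * Real.exp (θ * (p * r + x))
        + p * b / (θ + mu) * Real.exp (θ * (p * r + x)) *
          ∑' m, gammaTerm p r (θ + mu) b (p * r + x) m
        + Real.exp (-(mu * (p * r + x))) / (r * (θ + mu)) *
          ∑' m : ℕ, (r * (p * r + x) * (lam * mu)) ^ (m + 1) / (m ! * (m + 1)! : ℝ)) := by
  have hr₀ : (r : ℝ) ≠ 0 := by exact_mod_cast hr.ne'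
  have hsum := hNU.hasSum_kendallIntegral_cramerLundberg hlam hmu hr hxp hx
    (g := fun y => Real.exp (θ * y)) (by fun_prop)
  set L := p * r + x
  have hL : 0 ≤ L := by linarith
  have hseries := (((summable_gammaTerm p r b ha.le hL).hasSum.mul_left
    (p * b / (θ + mu) * Real.exp (θ * L))).add
    ((summable_pow_succ_div_factorial_mul_factorial (r * L * (lam * mu))).hasSum.mul_left
      (Real.exp (-(mu * L)) / (r * (θ + mu))))).mul_left (Real.exp (-(lam * r)))
  suffices hterm : _ from by linarith [hsum.unique (hseries.congr_fun hterm)]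
  intro m
  have hint : ∫ y in (0 : ℝ)..L, y ^ m * Real.exp (-(mu * y)) *
        (Real.exp (θ * (L - y)) * ((p * r - y) / r))
      = Real.exp (θ * L) / r *
        ∫ y in (0 : ℝ)..L, y ^ m * Real.exp (-((θ + mu) * y)) * (p * r - y) := by
    rw [← intervalIntegral.integral_const_mul]
    refine intervalIntegral.integral_congr fun y _ => ?_
    have hexp : Real.exp (-(mu * y)) * Real.exp (θ * (L - y))
        = Real.exp (θ * L) * Real.exp (-((θ + mu) * y)) := by
      rw [← Real.exp_add, ← Real.exp_add]
      ring_nf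
    linear_combination (y ^ m * ((p * r - y) / r)) * hexp
  have hexp : Real.exp (-(mu * L)) = Real.exp (θ * L) * Real.exp (-((θ + mu) * L)) := by
    rw [← Real.exp_add]
    ring_nf
  rw [hint, integral_pow_mul_exp_mul_sub m ha hL, gammaTerm, hexp]
  set a := θ + mu
  rw [show lam * r * mu = p * r * b * a by linear_combination (-(r : ℝ)) * hab,
    show r * L * (lam * mu) = p * r * b * (L * a) by linear_combination (-(r : ℝ) * L) * hab,
    mul_pow (p * r * b) a, mul_pow (p * r * b) (L * a), pow_succ a (m + 1), pow_succ (p * r * b)]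
  field_simp

variable {q u v : ℝ} (h : IsRootPair p lam mu q u v)
include h

theorem IsClaimModel.kendallIntegral_expScale_cramerLundberg (hr : 0 < r) (hxp : -(p * r) ≤ x)
    (hx : x ≤ 0) :
    kendallIntegral (P.map (cramerLundberg p N U r)) r x (expScale p mu u v)
      = Real.exp (-lam * r) * (p * expScale p mu u v (p * r + x)
        + (mu + v) / (u - v) * Real.exp (u * (p * r + x)) *
          ∑' m, gammaTerm p r (u + mu) (v + mu) (p * r + x) m
        - (mu + u) / (u - v) * Real.exp (v * (p * r + x)) *
          ∑' m, gammaTerm p r (v + mu) (u + mu) (p * r + x) m) := by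
  have := hNU.isProbabilityMeasure_map_cramerLundberg p r
  have := h.p_pos
  have := h.sub_pos
  have hu := h.left_add_mu_pos
  have hv := h.right_add_mu_pos
  have hfun : expScale p mu u v = fun y => 1 / p * ((mu + u) / (u - v)) * Real.exp (u * y)
      - 1 / p * ((mu + v) / (u - v)) * Real.exp (v * y) := by
    funext y
    rw [expScale]
    ring
  rw [hfun, kendallIntegral_mul_sub_mul (hNU.ae_map_cramerLundberg_le p r) (by fun_prop)
      (by fun_prop),
    hNU.kendallIntegral_exp_cramerLundberg h.lam_pos.le h.mu_pos hr hxp hx hu h.mul_add_mu,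
    hNU.kendallIntegral_exp_cramerLundberg h.lam_pos.le h.mu_pos hr hxp hx hv
      (by rw [mul_comm (v + mu)]; exact h.mul_add_mu), add_comm mu u, add_comm mu v]
  have hr₀ : (r : ℝ) ≠ 0 := by exact_mod_cast hr.ne'
  rw [neg_mul]
  field_simp
  ring

theorem IsClaimModel.kendallIntegral_deriv_expScale_cramerLundberg (hr : 0 < r) :
    kendallIntegral (P.map (cramerLundberg p N U r)) r 0 (deriv (expScale p mu u v))
      = Real.exp (-lam * r) * (p * deriv (expScale p mu u v) (p * r)
        + (mu + v) / (u - v) * u * Real.exp (u * (p * r)) *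
          ∑' m, gammaTerm p r (u + mu) (v + mu) (p * r) m
        - (mu + u) / (u - v) * v * Real.exp (v * (p * r)) *
          ∑' m, gammaTerm p r (v + mu) (u + mu) (p * r) m
        + Real.exp (-mu * p * r) / (p * r) *
          ∑' m : ℕ, (p * lam * mu * (r : ℝ) ^ 2) ^ (m + 1) / (m ! * (m + 1)! : ℝ)) := by
  have := hNU.isProbabilityMeasure_map_cramerLundberg p r
  have hp := h.p_pos
  have := h.sub_pos
  have hu := h.left_add_mu_pos
  have hv := h.right_add_mu_pos
  have hr₀ : (0 : ℝ) < r := by exact_mod_cast hr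
  have hpr : -(p * r) ≤ 0 := neg_nonpos.2 (mul_pos hp hr₀).le
  have hfun : deriv (expScale p mu u v) = fun y =>
      1 / p * ((mu + u) / (u - v)) * u * Real.exp (u * y)
      - 1 / p * ((mu + v) / (u - v)) * v * Real.exp (v * y) := by
    funext y
    rw [(hasDerivAt_expScale p mu u v y).deriv]
    ring
  rw [hfun, kendallIntegral_mul_sub_mul (hNU.ae_map_cramerLundberg_le p r) (by fun_prop)
      (by fun_prop),
    hNU.kendallIntegral_exp_cramerLundberg h.lam_pos.le h.mu_pos hr hpr le_rfl hu h.mul_add_mu,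
    hNU.kendallIntegral_exp_cramerLundberg h.lam_pos.le h.mu_pos hr hpr le_rfl hv
      (by rw [mul_comm (v + mu)]; exact h.mul_add_mu), add_comm mu u, add_comm mu v]
  rw [add_zero, show r * (p * r) * (lam * mu) = p * lam * mu * (r : ℝ) ^ 2 by ring,
    show -(mu * (p * r)) = -mu * p * r by ring, neg_mul]
  field_simp
  ring

theorem IsClaimModel.kendallIntegral_expScale_zero_cramerLundberg (hr : 0 < r) :
    kendallIntegral (P.map (cramerLundberg p N U r)) r 0 (expScale p mu u v)
      = Real.exp (q * r) := by
  have hp := h.p_pos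
  have hs := h.sub_pos
  have hr₀ : (0 : ℝ) < r := by exact_mod_cast hr
  have hpr : 0 < p * r := mul_pos hp hr₀
  rw [hNU.kendallIntegral_expScale_cramerLundberg h hr (neg_nonpos.2 hpr.le) le_rfl, add_zero,
    expScale]
  have hswap := exp_mul_tsum_lowerGamma_sub_swap (mul_pos hpr h.left_add_mu_pos).le
    (mul_pos hpr h.right_add_mu_pos).le
  set S₁ := ∑' m, gammaTerm p r (u + mu) (v + mu) (p * r) m
  set S₂ := ∑' m, gammaTerm p r (v + mu) (u + mu) (p * r) m
  have hexp : ∀ θ : ℝ, Real.exp (θ * (p * r))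
      = Real.exp (-(mu * (p * r))) * Real.exp (p * r * (θ + mu)) := fun θ => by
    rw [← Real.exp_add]
    ring_nf
  have hexp_q : Real.exp (q * r) = Real.exp (-lam * r) * (Real.exp (-(mu * (p * r))) *
      Real.exp (p * r * (u + mu) + p * r * (v + mu))) := by
    rw [← Real.exp_add, ← Real.exp_add]
    congr 1
    linear_combination -(r : ℝ) * h.sum
  change _ + _ * S₁ - _ * S₂ = _ at hswap
  rw [hexp u, hexp v, hexp_q]
  have hS : (mu + u) * Real.exp (p * r * (u + mu)) - (mu + v) * Real.exp (p * r * (v + mu))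
      + (mu + v) * Real.exp (p * r * (u + mu)) * S₁ - (mu + u) * Real.exp (p * r * (v + mu)) * S₂
      = (u - v) * Real.exp (p * r * (u + mu) + p * r * (v + mu)) := by
    refine mul_left_cancel₀ hpr.ne' ?_
    linear_combination hswap
  generalize Real.exp (p * r * (u + mu) + p * r * (v + mu)) = E at hS ⊢
  generalize Real.exp (p * r * (u + mu)) = E₁ at hS ⊢
  generalize Real.exp (p * r * (v + mu)) = E₂ at hS ⊢
  field_simp
  linear_combination hS

end Model

end KendallIntegral

section Refraction

theorem deriv_indicator_Ici {f : ℝ → ℝ} {a x : ℝ} (hx : a < x) :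
    deriv ((Ici a).indicator f) x = deriv f x :=
  (eqOn_indicator.eventuallyEq_of_mem (Ici_mem_nhds hx)).deriv_eq

theorem refractedScale_of_nonpos (W WY : ℝ → ℝ) (delta a : ℝ) {x : ℝ} (hx : x ≤ 0) :
    refractedScale W WY delta x a = W (x - a) := by
  rcases hx.eq_or_lt with rfl | hneg
  · rw [refractedScale, if_neg (lt_irrefl 0), intervalIntegral.integral_same, mul_zero, add_zero]
  · rw [refractedScale, if_pos hneg]

variable {x z : ℝ}

theorem eqOn_indicator_mul_deriv_indicator (f g : ℝ → ℝ) (hx : 0 ≤ x) (hz : 0 < z) :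
    EqOn (fun y => (Ici 0).indicator g (x - y) * deriv ((Ici 0).indicator f) (y + z))
      (fun y => g (x - y) * deriv f (y + z)) (uIcc 0 x) := fun y hy => by
  obtain ⟨hy₀, hyx⟩ := uIcc_of_le hx ▸ hy
  simp only
  rw [indicator_of_mem (mem_Ici.2 (sub_nonneg.2 hyx)), deriv_indicator_Ici (by linarith)]

theorem intervalIntegrable_indicator_mul_deriv_indicator {f g : ℝ → ℝ}
    (hf : Continuous (deriv f)) (hg : Continuous g) (hx : 0 ≤ x) (hz : 0 < z) :
    IntervalIntegrable (fun y => (Ici 0).indicator g (x - y) * deriv ((Ici 0).indicator f) (y + z))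
      volume 0 x :=
  (Continuous.intervalIntegrable (by fun_prop) 0 x :
    IntervalIntegrable (fun y => g (x - y) * deriv f (y + z)) volume 0 x).congr
    ((eqOn_indicator_mul_deriv_indicator f g hx hz).symm.mono uIoc_subset_uIcc)

theorem intervalIntegrable_indicator_expScale (p mu u v p' u' v' : ℝ) (hx : 0 ≤ x) (hz : 0 < z) :
    IntervalIntegrable (fun y => (Ici 0).indicator (expScale p' mu u' v') (x - y) *
      deriv ((Ici 0).indicator (expScale p mu u v)) (y + z)) volume 0 x :=
  intervalIntegrable_indicator_mul_deriv_indicator (continuous_deriv_expScale ..)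
    (continuous_expScale ..) hx hz

theorem refractedScale_indicator_of_nonneg (f g : ℝ → ℝ) (delta : ℝ) (hx : 0 ≤ x) (hz : 0 < z) :
    refractedScale ((Ici 0).indicator f) ((Ici 0).indicator g) delta x (-z)
      = f (x + z) + delta * ∫ y in (0 : ℝ)..x, g (x - y) * deriv f (y + z) := by
  have hxz : x + z ∈ Ici 0 := mem_Ici.2 (by linarith)
  simp only [refractedScale, if_neg (not_lt.2 hx), sub_neg_eq_add, indicator_of_mem hxz]
  rw [intervalIntegral.integral_congr (eqOn_indicator_mul_deriv_indicator f g hx hz)]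

/-- The function `(q + lam) W - p W'`, which is the contribution `lam E[W(x - U)]` of the claims
where `p W'(x) + lam (E[W(x - U)] - W(x)) = q W(x)`. -/
def claimPart (p lam q : ℝ) (W : ℝ → ℝ) (x : ℝ) : ℝ :=
  (q + lam) * W x - p * deriv W x

theorem continuous_claimPart_expScale (p lam mu q u v : ℝ) :
    Continuous (claimPart p lam q (expScale p mu u v)) :=
  ((continuous_expScale p mu u v).const_mul _).sub
    ((continuous_deriv_expScale p mu u v).const_mul _)

namespace IsRootPair

variable {p lam mu q u v : ℝ} (h : IsRootPair p lam mu q u v)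
include h

theorem claimPart_expScale (x : ℝ) : claimPart p lam q (expScale p mu u v) x
    = lam * mu / (p * (u - v)) * (Real.exp (u * x) - Real.exp (v * x)) := by
  have := h.p_pos
  have := h.sub_pos
  have hu : (mu + u) * (q + lam - p * u) = lam * mu := by linear_combination h.prod - u * h.sum
  have hv : (mu + v) * (q + lam - p * v) = lam * mu := by linear_combination h.prod - v * h.sum
  rw [claimPart, (hasDerivAt_expScale p mu u v x).deriv, expScale]
  field_simp
  linear_combination Real.exp (u * x) * hu - Real.exp (v * x) * hv

theorem hasDerivAt_claimPart_expScale (x : ℝ) :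
    HasDerivAt (claimPart p lam q (expScale p mu u v))
      (lam * mu * expScale p mu u v x - mu * claimPart p lam q (expScale p mu u v) x) x := by
  have := h.p_pos
  have := h.sub_pos
  rw [funext h.claimPart_expScale]
  refine (((hasDerivAt_exp_const_mul u x).sub (hasDerivAt_exp_const_mul v x)).const_mul
    (lam * mu / (p * (u - v)))).congr_deriv ?_
  simp only [expScale]
  field_simp
  ring

theorem exp_add_integral_expScale_mul_exp {delta θ : ℝ} (hθ : 0 < θ + mu)
    (hroot : cramerLundbergExponent (p + delta) lam mu θ = q) (x : ℝ) :
    Real.exp (θ * x) + delta * ∫ y in (0 : ℝ)..x,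
        expScale p mu u v (x - y) * (Real.exp (θ * y) * θ)
      = p * expScale p mu u v x - claimPart p lam q (expScale p mu u v) x / (θ + mu) := by
  have hderiv : ∀ y ∈ uIcc 0 x, HasDerivAt
      (fun y => -(Real.exp (θ * y) * (p * expScale p mu u v (x - y)
        - claimPart p lam q (expScale p mu u v) (x - y) / (θ + mu))))
      (delta * (expScale p mu u v (x - y) * (Real.exp (θ * y) * θ))) y := fun y _ => by
    have hW := (hasDerivAt_expScale p mu u v (x - y)).differentiableAt.hasDerivAt.comp_const_sub x y
    have hD := (h.hasDerivAt_claimPart_expScale (x - y)).comp_const_sub x y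
    refine ((hasDerivAt_exp_const_mul θ y).mul
      ((hW.const_mul p).sub (hD.div_const (θ + mu)))).neg.congr_deriv ?_
    simp only [Pi.sub_apply, claimPart]
    rw [cramerLundbergExponent] at hroot
    field_simp at hroot ⊢
    linear_combination -expScale p mu u v (x - y) * hroot
  have hcont := continuous_expScale p mu u v
  have hftc := intervalIntegral.integral_eq_sub_of_hasDerivAt hderiv
    (Continuous.intervalIntegrable (by fun_prop) _ _)
  rw [intervalIntegral.integral_const_mul] at hftc
  have := h.p_pos
  rw [hftc, sub_self, h.expScale_zero, sub_zero, h.claimPart_expScale 0]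
  simp only [mul_zero, sub_self, Real.exp_zero]
  field_simp
  ring

end IsRootPair

variable {p lam mu q delta u v u' v' : ℝ} (h : IsRootPair p lam mu q u v)
  (h' : IsRootPair (p - delta) lam mu q u' v')
include h h'

theorem expScale_add_integral_expScale_mul_deriv (x z : ℝ) :
    expScale p mu u v (x + z) + delta * ∫ y in (0 : ℝ)..x,
        expScale (p - delta) mu u' v' (x - y) * deriv (expScale p mu u v) (y + z)
      = (p - delta) * expScale (p - delta) mu u' v' x * expScale p mu u v z
        - 1 / (mu * lam) * claimPart (p - delta) lam q (expScale (p - delta) mu u' v') x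
          * claimPart p lam q (expScale p mu u v) z := by
  have := h.p_pos
  have := h.lam_pos
  have := h.mu_pos
  have := h.sub_pos
  have hu := h.left_add_mu_pos
  have hv := h.right_add_mu_pos
  have hcont := continuous_expScale (p - delta) mu u' v'
  have hint : ∀ θ : ℝ, IntervalIntegrable (fun y => expScale (p - delta) mu u' v' (x - y) *
      (Real.exp (θ * y) * θ)) volume 0 x := fun θ => Continuous.intervalIntegrable (by fun_prop) _ _
  have hsplit : ∫ y in (0 : ℝ)..x,
        expScale (p - delta) mu u' v' (x - y) * deriv (expScale p mu u v) (y + z)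
      = 1 / p * ((mu + u) / (u - v)) * Real.exp (u * z) *
          (∫ y in (0 : ℝ)..x, expScale (p - delta) mu u' v' (x - y) * (Real.exp (u * y) * u))
        - 1 / p * ((mu + v) / (u - v)) * Real.exp (v * z) *
          ∫ y in (0 : ℝ)..x, expScale (p - delta) mu u' v' (x - y) * (Real.exp (v * y) * v) := by
    rw [← intervalIntegral.integral_const_mul, ← intervalIntegral.integral_const_mul,
      ← intervalIntegral.integral_sub ((hint u).const_mul _) ((hint v).const_mul _)]
    refine intervalIntegral.integral_congr fun y _ => ?_
    simp only [(hasDerivAt_expScale p mu u v (y + z)).deriv, mul_add, Real.exp_add]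
    ring
  have hrefract_u := h'.exp_add_integral_expScale_mul_exp (delta := delta) hu
    (by rw [sub_add_cancel]; exact h.exponent_left) x
  have hrefract_v := h'.exp_add_integral_expScale_mul_exp (delta := delta) hv
    (by rw [sub_add_cancel]; exact h.exponent_right) x
  rw [eq_sub_iff_add_eq] at hrefract_u hrefract_v
  have hW : ∀ y, expScale p mu u v y = 1 / p * ((mu + u) / (u - v) * Real.exp (u * y)
      - (mu + v) / (u - v) * Real.exp (v * y)) := fun _ => rfl
  rw [hsplit, h.claimPart_expScale z]
  simp only [hW, mul_add, Real.exp_add]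
  generalize (∫ y in (0 : ℝ)..x, expScale (p - delta) mu u' v' (x - y) * (Real.exp (u * y) * u))
    = I₁ at hrefract_u ⊢
  generalize (∫ y in (0 : ℝ)..x, expScale (p - delta) mu u' v' (x - y) * (Real.exp (v * y) * v))
    = I₂ at hrefract_v ⊢
  field_simp at hrefract_u hrefract_v ⊢
  linear_combination Real.exp (u * z) * hrefract_u - Real.exp (v * z) * hrefract_v

theorem refractedScale_indicator_expScale_of_nonneg (hx : 0 ≤ x) (hz : 0 < z) :
    refractedScale ((Ici 0).indicator (expScale p mu u v))
        ((Ici 0).indicator (expScale (p - delta) mu u' v')) delta x (-z)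
      = (p - delta) * expScale (p - delta) mu u' v' x * expScale p mu u v z
        - 1 / (mu * lam) * claimPart (p - delta) lam q (expScale (p - delta) mu u' v') x
          * claimPart p lam q (expScale p mu u v) z := by
  rw [refractedScale_indicator_of_nonneg _ _ _ hx hz,
    expScale_add_integral_expScale_mul_deriv h h']

theorem eqOn_refractedScale_mul_of_nonneg (hx : 0 ≤ x) (r : ℝ) :
    EqOn (fun z => refractedScale ((Ici 0).indicator (expScale p mu u v))
        ((Ici 0).indicator (expScale (p - delta) mu u' v')) delta x (-z) * (z / r))
      (fun z => (Ici 0).indicator (fun y =>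
        (p - delta) * expScale (p - delta) mu u' v' x * expScale p mu u v y
          - 1 / (mu * lam) * claimPart (p - delta) lam q (expScale (p - delta) mu u' v') x
            * claimPart p lam q (expScale p mu u v) y) (0 + z) * (z / r)) (Ioi 0) := fun z hz => by
  simp only [refractedScale_indicator_expScale_of_nonneg h h' hx hz, zero_add,
    indicator_of_mem (Ioi_subset_Ici_self hz)]

end Refraction

section ParisianScale

variable {Ω : Type*} [MeasurableSpace Ω] {P : Measure Ω} {lam mu : ℝ} {N : ℝ≥0 → Ω → ℕ}
  {U : ℕ → Ω → ℝ} {p q delta u v u' v' x : ℝ} {r : ℝ≥0} (hNU : IsClaimModel P lam mu N U)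
  (h : IsRootPair p lam mu q u v) (h' : IsRootPair (p - delta) lam mu q u' v')
include hNU

theorem IsClaimModel.eqOn_laplaceExponent_cramerLundberg (hlam : 0 ≤ lam) (hmu : 0 < mu) (p : ℝ) :
    EqOn (laplaceExponent P (cramerLundberg p N U)) (cramerLundbergExponent p lam mu) (Ici 0) :=
  fun _ hθ => hNU.laplaceExponent_cramerLundberg hlam hmu p hθ

include h

theorem IsClaimModel.isScaleFunction_cramerLundberg :
    IsScaleFunction (laplaceExponent P (cramerLundberg p N U)) q
      ((Ici 0).indicator (expScale p mu u v)) :=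
  h.isScaleFunction (hNU.eqOn_laplaceExponent_cramerLundberg h.lam_pos.le h.mu_pos p)

theorem IsClaimModel.scaleFunction_cramerLundberg :
    scaleFunction (laplaceExponent P (cramerLundberg p N U)) q
      = (Ici 0).indicator (expScale p mu u v) :=
  h.scaleFunction_eq (hNU.eqOn_laplaceExponent_cramerLundberg h.lam_pos.le h.mu_pos p)

include h'

theorem IsClaimModel.parisianScale_cramerLundberg :
    parisianScale P (cramerLundberg p N U) delta q r x
    = ∫ z in Ioi 0, refractedScale ((Ici 0).indicator (expScale p mu u v))
        ((Ici 0).indicator (expScale (p - delta) mu u' v')) delta x (-z) * (z / r)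
      ∂(P.map (cramerLundberg p N U r)) := by
  rw [parisianScale, subtractDrift_cramerLundberg, hNU.scaleFunction_cramerLundberg h,
    hNU.scaleFunction_cramerLundberg h']

theorem IsClaimModel.integrableOn_refractedScale_cramerLundberg (x : ℝ) :
    IntegrableOn (fun z => refractedScale ((Ici 0).indicator (expScale p mu u v))
        ((Ici 0).indicator (expScale (p - delta) mu u' v')) delta x (-z) * (z / r))
      (Ioi 0) (P.map (cramerLundberg p N U r)) := by
  have := hNU.isProbabilityMeasure_map_cramerLundberg p r
  have hcont := continuous_expScale p mu u v
  have hcont' := continuous_claimPart_expScale p lam mu q u v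
  rcases le_total x 0 with hx | hx
  · simp only [refractedScale_of_nonpos _ _ _ _ hx, sub_neg_eq_add]
    exact integrableOn_indicator_comp_add_mul (hNU.ae_map_cramerLundberg_le p r) hcont r x
  · rw [integrableOn_congr_fun (eqOn_refractedScale_mul_of_nonneg h h' hx r) measurableSet_Ioi]
    exact integrableOn_indicator_comp_add_mul (hNU.ae_map_cramerLundberg_le p r) (by fun_prop) r 0

theorem IsClaimModel.parisianScale_cramerLundberg_of_nonpos (hx : x ≤ 0) :
    parisianScale P (cramerLundberg p N U) delta q r x
      = kendallIntegral (P.map (cramerLundberg p N U r)) r x (expScale p mu u v) := by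
  simp only [hNU.parisianScale_cramerLundberg h h', refractedScale_of_nonpos _ _ _ _ hx,
    sub_neg_eq_add, kendallIntegral]

theorem IsClaimModel.parisianScale_cramerLundberg_eq_zero (hx : x < -(p * r)) :
    parisianScale P (cramerLundberg p N U) delta q r x = 0 := by
  have hpr : 0 ≤ p * r := mul_nonneg h.p_pos.le r.coe_nonneg
  rw [hNU.parisianScale_cramerLundberg_of_nonpos h h' (by linarith)]
  exact kendallIntegral_eq_zero (hNU.ae_map_cramerLundberg_le p r) hx _ _

theorem IsClaimModel.parisianScale_cramerLundberg_of_nonneg (hr : 0 < r) (hx : 0 ≤ x) :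
    parisianScale P (cramerLundberg p N U) delta q r x
      = Real.exp (q * r) * (p - delta) * expScale (p - delta) mu u' v' x
        - 1 / (mu * lam) * claimPart (p - delta) lam q (expScale (p - delta) mu u' v') x
          * ((q + lam) * Real.exp (q * r)
            - p * kendallIntegral (P.map (cramerLundberg p N U r)) r 0
                (deriv (expScale p mu u v))) := by
  have := hNU.isProbabilityMeasure_map_cramerLundberg p r
  have hν := hNU.ae_map_cramerLundberg_le p r
  have hclaim : kendallIntegral (P.map (cramerLundberg p N U r)) r 0
        (claimPart p lam q (expScale p mu u v))
      = (q + lam) * Real.exp (q * r) - p * kendallIntegral (P.map (cramerLundberg p N U r)) r 0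
          (deriv (expScale p mu u v)) := by
    rw [← hNU.kendallIntegral_expScale_zero_cramerLundberg h hr]
    exact kendallIntegral_mul_sub_mul hν (continuous_expScale p mu u v)
      (continuous_deriv_expScale p mu u v) r 0 (q + lam) p
  rw [hNU.parisianScale_cramerLundberg h h', setIntegral_congr_fun measurableSet_Ioi
    (eqOn_refractedScale_mul_of_nonneg h h' hx r), ← kendallIntegral,
    kendallIntegral_mul_sub_mul hν (continuous_expScale p mu u v)
      (continuous_claimPart_expScale p lam mu q u v), hclaim,
    hNU.kendallIntegral_expScale_zero_cramerLundberg h hr]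
  ring

end ParisianScale

end ParisianRefracted

end

theorem mainTheorem10 {Ω : Type*} [MeasurableSpace Ω] (P : Measure Ω) [IsProbabilityMeasure P]
    (p lam mu delta q : ℝ) (r : ℝ≥0)
    (hlam : 0 < lam) (hmu : 0 < mu) (hdelta : 0 < delta) (hp : delta < p) (hr : 0 < r)
    (hq : 0 ≤ q) (hq0 : q = 0 → lam ≠ mu * p ∧ lam ≠ mu * (p - delta))
    (N : ℝ≥0 → Ω → ℕ) (U : ℕ → Ω → ℝ) (hNU : ParisianRefracted.IsClaimModel P lam mu N U) :
    let X : ℝ≥0 → Ω → ℝ := ParisianRefracted.cramerLundberg p N U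
    let Y : ℝ≥0 → Ω → ℝ := ParisianRefracted.subtractDrift X delta
    let W : ℝ → ℝ := ParisianRefracted.scaleFunction (ParisianRefracted.laplaceExponent P X) q
    let WY : ℝ → ℝ := ParisianRefracted.scaleFunction (ParisianRefracted.laplaceExponent P Y) q
    let V : ℝ → ℝ := ParisianRefracted.parisianScale P X delta q r
    let qp : ℝ := ParisianRefracted.rootPos p lam mu q
    let qm : ℝ := ParisianRefracted.rootNeg p lam mu q
    let Ap : ℝ := ParisianRefracted.coefPos p lam mu q
    let Am : ℝ := ParisianRefracted.coefNeg p lam mu q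
    let qpY : ℝ := ParisianRefracted.rootPos (p - delta) lam mu q
    let qmY : ℝ := ParisianRefracted.rootNeg (p - delta) lam mu q
    let ApY : ℝ := ParisianRefracted.coefPos (p - delta) lam mu q
    let AmY : ℝ := ParisianRefracted.coefNeg (p - delta) lam mu q
    let C : ℝ := Real.exp (-lam * r) *
      (p * deriv W (p * r)
        + Am * qp * Real.exp (qp * (p * r)) *
          ∑' m : ℕ, ParisianRefracted.gammaTerm p r (qp + mu) (qm + mu) (p * r) m
        - Ap * qm * Real.exp (qm * (p * r)) *
          ∑' m : ℕ, ParisianRefracted.gammaTerm p r (qm + mu) (qp + mu) (p * r) m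
        + Real.exp (-mu * p * r) / (p * r) *
          ∑' m : ℕ, (p * lam * mu * (r : ℝ) ^ 2) ^ (m + 1) / (m ! * (m + 1)! : ℝ))
    -- the scale functions exist and have the explicit form
    (ParisianRefracted.IsScaleFunction (ParisianRefracted.laplaceExponent P X) q W
      ∧ ParisianRefracted.IsScaleFunction (ParisianRefracted.laplaceExponent P Y) q WY
      ∧ (∀ x : ℝ, 0 ≤ x → W x = 1 / p * (Ap * Real.exp (qp * x) - Am * Real.exp (qm * x)))
      ∧ (∀ x : ℝ, 0 ≤ x →
          WY x = 1 / (p - delta) * (ApY * Real.exp (qpY * x) - AmY * Real.exp (qmY * x))))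
    -- the integrals that define `w` and `V` exist and the series converge
    ∧ (∀ x z : ℝ, 0 ≤ x → 0 < z →
        IntervalIntegrable (fun y => WY (x - y) * deriv W (y + z)) volume 0 x)
    ∧ (∀ x : ℝ, IntegrableOn
        (fun z => ParisianRefracted.refractedScale W WY delta x (-z) * (z / r))
        (Ioi 0) (P.map (X r)))
    ∧ (∀ L : ℝ, 0 ≤ L →
        Summable (ParisianRefracted.gammaTerm p r (qp + mu) (qm + mu) L)
        ∧ Summable (ParisianRefracted.gammaTerm p r (qm + mu) (qp + mu) L))
    ∧ Summable (fun m : ℕ => (p * lam * mu * (r : ℝ) ^ 2) ^ (m + 1) / (m ! * (m + 1)! : ℝ))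
    -- the three regimes
    ∧ (∀ x : ℝ, 0 < x →
        V x = Real.exp (q * r) * (p - delta) * WY x
          - 1 / (mu * lam) * ((q + lam) * WY x - (p - delta) * deriv WY x)
            * ((q + lam) * Real.exp (q * r) - p * C))
    ∧ (∀ x : ℝ, -(p * r) ≤ x → x ≤ 0 →
        V x = Real.exp (-lam * r) *
          (p * W (x + p * r)
            + Am * Real.exp (qp * (x + p * r)) *
              ∑' m : ℕ, ParisianRefracted.gammaTerm p r (qp + mu) (qm + mu) (p * r + x) m
            - Ap * Real.exp (qm * (x + p * r)) *
              ∑' m : ℕ, ParisianRefracted.gammaTerm p r (qm + mu) (qp + mu) (p * r + x) m))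
    ∧ (∀ x : ℝ, x < -(p * r) → V x = 0) := by
  intro X Y W WY V qp qm Ap Am qpY qmY ApY AmY C
  have h := ParisianRefracted.isRootPair_rootPos_rootNeg (hdelta.trans hp) hlam hmu hq
    fun h₀ => (hq0 h₀).1
  have h' := ParisianRefracted.isRootPair_rootPos_rootNeg (sub_pos.2 hp) hlam hmu hq
    fun h₀ => (hq0 h₀).2
  have hY : Y = ParisianRefracted.cramerLundberg (p - delta) N U :=
    ParisianRefracted.subtractDrift_cramerLundberg p delta N U
  have hW : W = _ := hNU.scaleFunction_cramerLundberg h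
  have hWY : WY = (Ici 0).indicator (ParisianRefracted.expScale (p - delta) mu qpY qmY) := by
    simpa only [WY, hY] using hNU.scaleFunction_cramerLundberg h'
  have hC : C = ParisianRefracted.kendallIntegral (P.map (X r)) r 0
      (deriv (ParisianRefracted.expScale p mu qp qm)) := by
    simp only [C, hW, ParisianRefracted.deriv_indicator_Ici (mul_pos h.p_pos (NNReal.coe_pos.2 hr))]
    exact (hNU.kendallIntegral_deriv_expScale_cramerLundberg h hr).symm
  refine ⟨⟨hW ▸ hNU.isScaleFunction_cramerLundberg h,
    hWY ▸ hY ▸ hNU.isScaleFunction_cramerLundberg h',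
    fun x hx => hW ▸ indicator_of_mem (mem_Ici.2 hx) _,
    fun x hx => hWY ▸ indicator_of_mem (mem_Ici.2 hx) _⟩, fun x z hx hz =>
      hW ▸ hWY ▸ ParisianRefracted.intervalIntegrable_indicator_expScale _ _ _ _ _ _ _ hx hz,
    hW ▸ hWY ▸ hNU.integrableOn_refractedScale_cramerLundberg h h',
    fun L hL => ⟨ParisianRefracted.summable_gammaTerm p r _ h.left_add_mu_pos.le hL,
      ParisianRefracted.summable_gammaTerm p r _ h.right_add_mu_pos.le hL⟩,
    ParisianRefracted.summable_pow_succ_div_factorial_mul_factorial _, fun x hx => ?_,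
    fun x hxp hx => ?_, fun x => hNU.parisianScale_cramerLundberg_eq_zero h h'⟩
  · rw [hC, hWY, ParisianRefracted.deriv_indicator_Ici hx, indicator_of_mem (mem_Ici.2 hx.le)]
    exact hNU.parisianScale_cramerLundberg_of_nonneg h h' hr hx.le
  · rw [hW, indicator_of_mem (mem_Ici.2 (by linarith)), add_comm x]
    exact (hNU.parisianScale_cramerLundberg_of_nonpos h h' hx).trans
      (hNU.kendallIntegral_expScale_cramerLundberg h hr hxp hx)
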